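/- Let $m,n\ge 0$ be integers with $2n+1\le m$, put $p=m-n$, and let $\mathfrak g=\mathfrak{so}_{2m}(\mathbb C)=\{Y : Y^{\top}Q+QY=0\}$ with $Q=\begin{pmatrix}0&1_m\\1_m&0\end{pmatrix}$, the Lie algebra of the group $G=SO_{2m}(\mathbb C)$ of this form. Let $J_l$ be the $l\times l$ nilpotent Jordan block (ones on the superdiagonal), $\mathcal E_{j,k}$ the $j\times k$ matrix whose only nonzero entry is a $1$ at place $(j,k)$ (the zero matrix if $j=0$ or $k=0$), and $\mathcal F_l$ the $l\times l$ matrix with $1$ at place $(l-1,l)$, $-1$ at place $(l,l-1)$ and zeros elsewhere. In block form, with blocks of sizes $p,n,p,n$, set $$X_n=\begin{pmatrix} J_p&0&\mathcal F_p&\mathcal E_{p,n}\\ 0&J_n&-\mathcal E_{n,p}&0\\ 0&0&-J_p^{\top}&0\\ 0&0&0&-J_n^{\top}\end{pmatrix}\in\mathfrak g .$$ For $a,y\in\mathbb C^n$, $z\in\mathbb C^{n+1}$, $d\in\mathbb C^{p-1}$ set $$S(a_i,y_i,z_j,d_k)=X_n+\begin{pmatrix} -M_{z,d}&a_1\mathcal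 E_{p,n}&0&0\\ 0&0&0&0\\ M_d&M_y&M_{z,d}^{\top}&0\\ -M_y^{\top}&M_a&-a_1\mathcal E_{n,p}&0\end{pmatrix},$$ where $M_d$ ($p\times p$) and $M_a$ ($n\times n$) are the antisymmetric tridiagonal matrices with superdiagonals $(d_{p-1},\dots,d_1)$ and $(a_n,\dots,a_2)$; $M_y$ is the $p\times n$ matrix with first row $(y_1,\dots,y_n)$ and all other rows zero; and $M_{z,d}$ is the $p\times p$ matrix whose last row is $(z_1,\dots,z_{n+1},0,\dots,0)$ with $d_1$ added at place $(p,p-1)$, all other rows being zero. (Terms in $a_1$ are absent if $n=0$, and terms in $d_1$ if $p=1$.) Let $\mathcal S_n$ be the set of all these matrices. Theorem. The matrix $X_n$ is nilpotent with two Jordan blocks, of sizes $2(m-n)-1$ and $2n+1$. The set $\mathcal S_n$ is an affine subspace of $\mathfrak g$ which is a $\lambda$-invariant transverse slice at $X_n$ to the adjoint orbit of $X_n$, that is: * (transversality) $X_n\in\mathcal S_n$, and $\mathfrak g$ is the direct sum of the direction of $\mathcal S_n$ and of the tangent space at $X_n$ of the adjoint orbit $\{gX_ng^{-1}: g\in G\}$;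 * ($\lambda$-invariance) there are $H,N\in\mathfrak g$ with $[H,X_n]=2X_n$, $[H,N]=-2N$, $[X_n,N]=H$ such that, for every $r\in\mathbb C^{*}$, the map $\lambda_r(Y)=r\exp(-\log(r)H/2)\,Y\exp(\log(r)H/2)$ sends $\mathcal S_n$ into itself. Moreover, the characteristic polynomial $\chi_S(t)=\det(t-S)$ of $S=S(a_i,y_i,z_j,d_k)$ is $$\chi_S(t)=t^2A(t)D(t)+(-1)^mB(t)B(-t),$$ where $$A(t)=t^{2n}+\sum_{i=1}^{n}(-1)^{i}a_i\,t^{2(n-i)},\qquad D(t)=\sum_{k=1}^{m-n-1}(-1)^{k+1}\,4d_k\,t^{2(m-n-1-k)},$$ $$B(t)=\sum_{i=1}^{n}y_i t^{i-1}-t^n\Bigl(\sum_{j=1}^{n+1}(-1)^{j-1}z_j t^{j-1}+(-1)^{m-n}t^{m-n}\Bigr).$$ -/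

import Mathlib

open Polynomial

noncomputable section

namespace TypeDSlice

/-- The `2|l| × 2|l|` complex matrices, with rows and columns split as `l ⊕ l`. -/
abbrev Mat (l : Type) : Type := Matrix (l ⊕ l) (l ⊕ l) ℂ

section General

variable {l : Type} [Fintype l] [DecidableEq l]

/-- The complex special orthogonal group of the symmetric form `[[0, 1], [1, 0]]`. -/
def specialOrthogonalD (l : Type) [Fintype l] [DecidableEq l] : Set (Mat l) :=
  {g | g.transpose * LieAlgebra.Orthogonal.JD l ℂ * g = LieAlgebra.Orthogonal.JD l ℂ ∧ g.det = 1}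

/-- The Lie algebra `so_{2|l|}(ℂ)` of the form `[[0, 1], [1, 0]]`, as a space of matrices. -/
def soD (l : Type) [Fintype l] [DecidableEq l] : Submodule ℂ (Mat l) :=
  skewAdjointMatricesSubmodule (LieAlgebra.Orthogonal.JD l ℂ)

/-- The tangent space at `X` to the adjoint orbit of `X`: the velocities at `t = 0` of the curves
`t ↦ g(t) X g(t)⁻¹`, where `g` is a holomorphic curve in the group with `g(0) = 1`. -/
def orbitTangentSpace (X : Mat l) : Submodule ℂ (Mat l) :=
  Submodule.span ℂ
    {v | ∃ g : ℂ → Mat l, (∀ t, g t ∈ specialOrthogonalD l) ∧ g 0 = 1 ∧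
      (∀ i j, Differentiable ℂ fun t => g t i j) ∧
      ∀ i j, HasDerivAt (fun t => (g t * X * (g t)⁻¹) i j) (v i j) 0}

/-- An affine subspace `S` of `so_{2|l|}(ℂ)` is a transverse slice at `X` to the adjoint orbit
of `X`: it passes through `X`, and its tangent space there is a linear complement in
`so_{2|l|}(ℂ)` of the tangent space of the orbit. -/
structure IsTransverseSlice (X : Mat l) (S : AffineSubspace ℂ (Mat l)) : Prop where
  subset_so : (S : Set (Mat l)) ⊆ soD l
  mem : X ∈ S
  inf_eq_bot : orbitTangentSpace X ⊓ S.direction = ⊥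
  sup_eq_so : orbitTangentSpace X ⊔ S.direction = soD l

/-- `H, X, N` is a Jacobson-Morozov triple in `so_{2|l|}(ℂ)` with nilpositive element `X`
(the trivial triple `0, 0, 0` is allowed). -/
structure IsJMTriple (H X N : Mat l) : Prop where
  memH : H ∈ soD l
  memX : X ∈ soD l
  memN : N ∈ soD l
  lie_H_X : H * X - X * H = (2 : ℂ) • X
  lie_H_N : H * N - N * H = (-2 : ℂ) • N
  lie_X_N : X * N - N * X = H

/-- The transformation `λ_r(Y) = r exp(-log(r) H / 2) Y exp(log(r) H / 2)`. -/
def lam (H : Mat l) (r : ℂ) (Y : Mat l) : Mat l :=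
  r • (NormedSpace.exp (-(Complex.log r / 2) • H) * Y * NormedSpace.exp ((Complex.log r / 2) • H))

/-- `S` is `λ`-invariant, where `λ` is the `ℂˣ`-action given by some Jacobson-Morozov triple
with nilpositive element `X`. -/
def IsLambdaInvariant (X : Mat l) (S : Set (Mat l)) : Prop :=
  ∃ H N : Mat l, IsJMTriple H X N ∧ ∀ r : ℂ, r ≠ 0 → ∀ Y ∈ S, lam H r Y ∈ S

end General

/-- The entry `c_i` of `c = (c_1, …, c_k)`, counted from `1`; zero when `i` is out of range. -/
def coord {k : ℕ} (c : Fin k → ℂ) (i : ℕ) : ℂ :=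
  if h : 1 ≤ i ∧ i ≤ k then c ⟨i - 1, by omega⟩ else 0

/-- The principal nilpotent Jordan block of size `k`. -/
def jordanBlock (k : ℕ) : Matrix (Fin k) (Fin k) ℂ :=
  Matrix.of fun i j => if (i : ℕ) + 1 = j then 1 else 0

/-- The `j × k` matrix with `1` in the last row and last column and zeros elsewhere. -/
def cornerMat (j k : ℕ) : Matrix (Fin j) (Fin k) ℂ :=
  Matrix.of fun s t => if (s : ℕ) + 1 = j ∧ (t : ℕ) + 1 = k then 1 else 0

/-- The `k × k` matrix with `1` at place `(k-1, k)` and `-1` at place `(k, k-1)`, counted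
from `1`, and zeros elsewhere. -/
def skewCorner (k : ℕ) : Matrix (Fin k) (Fin k) ℂ :=
  Matrix.of fun i j =>
    if (i : ℕ) + 2 = k ∧ (j : ℕ) + 1 = k then 1
    else if (i : ℕ) + 1 = k ∧ (j : ℕ) + 2 = k then -1 else 0

/-- A matrix has the Jordan normal form with two nilpotent blocks, of sizes `p` and `q`. -/
def HasNilpotentJordanType {ι : Type} [Fintype ι] [DecidableEq ι] (X : Matrix ι ι ℂ)
    (p q : ℕ) : Prop :=
  ∃ (P : Matrix ι (Fin p ⊕ Fin q) ℂ) (Q : Matrix (Fin p ⊕ Fin q) ι ℂ), P * Q = 1 ∧ Q * P = 1 ∧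
    Q * X * P = Matrix.fromBlocks (jordanBlock p) 0 0 (jordanBlock q)

/-- The index set `{1, …, m}`, split into its first `m - n` and its last `n` elements. -/
abbrev Idx (m n : ℕ) : Type := Fin (m - n) ⊕ Fin n

/-- The nilpotent element `X_n` of `so_{2m}(ℂ)`. -/
def nilp (m n : ℕ) : Mat (Idx m n) :=
  Matrix.fromBlocks
    (Matrix.fromBlocks (jordanBlock (m - n)) 0 0 (jordanBlock n))
    (Matrix.fromBlocks (skewCorner (m - n)) (cornerMat (m - n) n) (-cornerMat n (m - n)) 0)
    0
    (Matrix.fromBlocks (-(jordanBlock (m - n)).transpose) 0 0 (-(jordanBlock n).transpose))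

/-- The antisymmetric matrix `M_d`, with superdiagonal `d_{m-n-1}, …, d_1`. -/
def matD (m n : ℕ) (d : Fin (m - n - 1) → ℂ) : Matrix (Fin (m - n)) (Fin (m - n)) ℂ :=
  Matrix.of fun i j =>
    if (i : ℕ) + 1 = j then coord d (m - n - 1 - i)
    else if (j : ℕ) + 1 = i then -coord d (m - n - 1 - j) else 0

/-- The antisymmetric matrix `M_a`, with superdiagonal `a_n, …, a_2`. -/
def matA (n : ℕ) (a : Fin n → ℂ) : Matrix (Fin n) (Fin n) ℂ :=
  Matrix.of fun i j =>
    if (i : ℕ) + 1 = j then coord a (n - i)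
    else if (j : ℕ) + 1 = i then -coord a (n - j) else 0

/-- The matrix `M_y`, with first row `y_1, …, y_n` and zeros elsewhere. -/
def matY (m n : ℕ) (y : Fin n → ℂ) : Matrix (Fin (m - n)) (Fin n) ℂ :=
  Matrix.of fun i j => if (i : ℕ) = 0 then y j else 0

/-- The matrix `M_{z,d}`: the last row of `M_z` is `z_1, …, z_{n+1}, 0, …, 0`, its other rows
vanish, and `d_1` is added at place `(m-n, m-n-1)`, counted from `1`. -/
def matZD (m n : ℕ) (z : Fin (n + 1) → ℂ) (d : Fin (m - n - 1) → ℂ) :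
    Matrix (Fin (m - n)) (Fin (m - n)) ℂ :=
  Matrix.of fun i j =>
    (if (i : ℕ) + 1 = m - n then coord z (j + 1) else 0) +
    (if (i : ℕ) + 1 = m - n ∧ (j : ℕ) + 2 = m - n then coord d 1 else 0)

/-- The element `S(a_i, y_i, z_j, d_k)`. -/
def slicePoint (m n : ℕ) (a y : Fin n → ℂ) (z : Fin (n + 1) → ℂ) (d : Fin (m - n - 1) → ℂ) :
    Mat (Idx m n) :=
  nilp m n +
    Matrix.fromBlocks
      (Matrix.fromBlocks (-matZD m n z d) (coord a 1 • cornerMat (m - n) n) 0 0)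
      0
      (Matrix.fromBlocks (matD m n d) (matY m n y) (-(matY m n y).transpose) (matA n a))
      (Matrix.fromBlocks (matZD m n z d).transpose 0 (-(coord a 1 • cornerMat n (m - n))) 0)

/-- The set `𝒮_n` of all the elements `S(a_i, y_i, z_j, d_k)`. -/
def slice (m n : ℕ) : Set (Mat (Idx m n)) :=
  {Y | ∃ (a y : Fin n → ℂ) (z : Fin (n + 1) → ℂ) (d : Fin (m - n - 1) → ℂ),
    Y = slicePoint m n a y z d}

/-- `A(t) = t^{2n} - a_1 t^{2(n-1)} + ⋯ + (-1)^n a_n`. -/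
def polyA (n : ℕ) (a : Fin n → ℂ) : ℂ[X] :=
  X ^ (2 * n) + ∑ i ∈ Finset.Icc 1 n, C ((-1) ^ i * coord a i) * X ^ (2 * (n - i))

/-- `D(t) = 4 d_1 t^{2(m-n-2)} - 4 d_2 t^{2(m-n-3)} + ⋯ + (-1)^{m-n} 4 d_{m-n-1}`. -/
def polyD (m n : ℕ) (d : Fin (m - n - 1) → ℂ) : ℂ[X] :=
  ∑ k ∈ Finset.Icc 1 (m - n - 1),
    C ((-1) ^ (k + 1) * 4 * coord d k) * X ^ (2 * (m - n - 1 - k))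

/-- `B(t) = y_1 + y_2 t + ⋯ + y_n t^{n-1}
  - t^n (z_1 - z_2 t + ⋯ + (-1)^n z_{n+1} t^n + (-1)^{m-n} t^{m-n})`. -/
def polyB (m n : ℕ) (y : Fin n → ℂ) (z : Fin (n + 1) → ℂ) : ℂ[X] :=
  ∑ i ∈ Finset.Icc 1 n, C (coord y i) * X ^ (i - 1) -
    X ^ n * (∑ j ∈ Finset.Icc 1 (n + 1), C ((-1) ^ (j - 1) * coord z j) * X ^ (j - 1) +
      C ((-1) ^ (m - n)) * X ^ (m - n))

end TypeDSlice

end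

/-!
Write `p = m - n = q + 1` and let `e_1, …, e_p, f_1, …, f_n` and their duals `e*_1, …, f*_n` be the
standard basis of `ℂ^{2m}`, so that the form pairs `e_k` with `e*_k` and `f_k` with `f*_k`. For
vectors `x, y` put `(x ∧ y) v = (y, v) x - (x, v) y` (`wedge`); these matrices lie in `so_{2m}`.

Everything rests on two chains of `T = -X_n`: the vectors `u_k = T^k u_0` (`vecU`) starting at
`u_0 = e*_1` (at `e_1 + e*_1` if `p = 1`), and `w_k = T^k w_0` (`vecW`) starting at `w_0 = f*_1`
(at `w_0 = -e_p` if `n = 0`). In terms of these, a point of the slice is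
(`slicePoint_eq_add_sliceVector`)
`X_n + ∑ d_{q-k} u_k ∧ u_{k+1} + ∑ a_{n-k} w_k ∧ w_{k+1}
  + ∑ y_{k+1} u_0 ∧ w_k - ∑ z_{k+1} u_k ∧ w_n`.

* *Jordan type.* The vectors `u_0` and `w = w_0 + u_{q-n} / 2` (`vecW'`) are killed by `T^{2q+1}`
  and `T^{2n+1}` and generate the whole space, so by dimension their chains form a Jordan basis
  (`hasNilpotentJordanType_of_chains`).
* *`λ`-invariance.* A diagonal `H` makes all `u_k`, `w_k` weight vectors and `u_0`, `w` lowest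
  weight vectors. The Jordan basis gives a lowering element in `gl_{2m}`
  (`exists_lowering_of_chains`), and averaging over the involution `Y ↦ -J Yᵀ J` moves it into
  `so_{2m}` (`exists_isJMTriple`). The action `λ_r` rescales each wedge of weight vectors, hence
  each coordinate of the slice.
* *Transversality.* The tangent space to the orbit is `[so, X_n]` (`mem_orbitTangentSpace_iff`),
  whose orthogonal complement for the trace form is the centralizer of `X_n`. An element `c` of the
  centralizer is determined by the moments `(u_0, c T^k u_0)`, `(u_0, c T^k w_0)`,
  `(w_0, c T^k w_0)`, and orthogonality to the wedges above kills them all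
  (`eq_zero_of_commute_of_trace_eq_zero`); so the two spaces span `so_{2m}`. They meet in zero
  because the functionals `s ↦ ∑_{i+j=K} (-1)^i (T^i x, s T^j y)`, for `x` and `y` among `u_0` and
  `w`, vanish on commutators with `X_n` by telescoping but recover the coordinates `a`, then `y`
  and `z`, then `d` (`alternatingPairing_commutator`, `sliceVector_eq_zero`).
* *Characteristic polynomial.* Fix a scalar `t` and consider the bilinear form `(x, (t - S) y)`,
  whose determinant is `(-1)^m det (t - S)`. The `u_k`, `k < q`, and `w_k`, `k < n`, span an
  isotropic subspace for it. Let `R_u(t) = ∑ t^i e_{i+1}` and `R_w(t) = ∑ t^j β_{j+1}`, where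
  `β_j = f_j` for `j ≤ n` and `β_{n+1} = e_p - e*_p` (`genU`, `genW`). This isotropic subspace is
  orthogonal to `R_u(-t)` and `R_w(-t)` on the left and to `R_u(t)` and `R_w(t)` on the right. In
  frames adapted to these vectors the Gram determinant collapses to the `2 × 2` determinant of the
  pairings of the `R`'s (`det_gram_eq_det_toBlocks`), and these pairings are `(-1)^q t D(t) / 2`,
  `-2 (-1)^n t A(t)`, `-B(t)` and `B(-t)`.
-/

noncomputable section

namespace TypeDSlice

/-! ### The symmetric form and its skew-adjoint matrices -/

section Form

variable {l : Type} [Fintype l] [DecidableEq l]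

/-- The symmetric bilinear form of the matrix `JD`, which defines `so_{2|l|}(ℂ)`. -/
def form (l : Type) [Fintype l] [DecidableEq l] : LinearMap.BilinForm ℂ (l ⊕ l → ℂ) :=
  Matrix.toBilin' (LieAlgebra.Orthogonal.JD l ℂ)

lemma form_eq_dotProduct (x y : l ⊕ l → ℂ) :
    form l x y = x ⬝ᵥ (LieAlgebra.Orthogonal.JD l ℂ).mulVec y := by
  simp [form, Matrix.toBilin'_apply']

omit [Fintype l] in
lemma JD_transpose : (LieAlgebra.Orthogonal.JD l ℂ).transpose = LieAlgebra.Orthogonal.JD l ℂ := by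
  simp [LieAlgebra.Orthogonal.JD, Matrix.fromBlocks_transpose]

lemma JD_mul_self : LieAlgebra.Orthogonal.JD l ℂ * LieAlgebra.Orthogonal.JD l ℂ = 1 := by
  simp [LieAlgebra.Orthogonal.JD, Matrix.fromBlocks_multiply]

lemma form_comm (x y : l ⊕ l → ℂ) : form l x y = form l y x := by
  rw [form_eq_dotProduct, form_eq_dotProduct, Matrix.dotProduct_mulVec, dotProduct_comm,
    ← Matrix.mulVec_transpose, JD_transpose]

@[simp]
lemma form_single_inl (i : l) (y : l ⊕ l → ℂ) :
    form l (Pi.single (Sum.inl i) 1) y = y (Sum.inr i) := by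
  rw [form_eq_dotProduct, single_one_dotProduct]
  simp [LieAlgebra.Orthogonal.JD, Matrix.mulVec, dotProduct, Fintype.sum_sum_type,
    Matrix.one_apply]

@[simp]
lemma form_single_inr (i : l) (y : l ⊕ l → ℂ) :
    form l (Pi.single (Sum.inr i) 1) y = y (Sum.inl i) := by
  rw [form_eq_dotProduct, single_one_dotProduct]
  simp [LieAlgebra.Orthogonal.JD, Matrix.mulVec, dotProduct, Fintype.sum_sum_type,
    Matrix.one_apply]

lemma eq_zero_of_form_eq_zero {x : l ⊕ l → ℂ} (h : ∀ y, form l y x = 0) : x = 0 := by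
  ext (i | i)
  · simpa using h (Pi.single (Sum.inr i) 1)
  · simpa using h (Pi.single (Sum.inl i) 1)

lemma mem_soD_iff {A : Mat l} :
    A ∈ soD l ↔ A.transpose * LieAlgebra.Orthogonal.JD l ℂ =
      -(LieAlgebra.Orthogonal.JD l ℂ * A) := by
  rw [soD, mem_skewAdjointMatricesSubmodule, Matrix.IsSkewAdjoint, Matrix.IsAdjointPair, mul_neg]

lemma form_mulVec_of_mem_soD {A : Mat l} (hA : A ∈ soD l) (x y : l ⊕ l → ℂ) :
    form l (A.mulVec x) y = -form l x (A.mulVec y) := by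
  rw [form_eq_dotProduct, form_eq_dotProduct, Matrix.mulVec_mulVec, ← Matrix.vecMul_transpose,
    ← Matrix.dotProduct_mulVec, Matrix.mulVec_mulVec, mem_soD_iff.1 hA, Matrix.neg_mulVec,
    dotProduct_neg]

/-- For `A` skew-adjoint and the symmetric form, `(x, Ax) = 0`. -/
lemma form_mulVec_self {A : Mat l} (hA : A ∈ soD l) (x : l ⊕ l → ℂ) :
    form l x (A.mulVec x) = 0 := by
  have h := form_mulVec_of_mem_soD hA x x
  rw [form_comm] at h
  linear_combination h / 2

lemma commutator_mem_soD {A B : Mat l} (hA : A ∈ soD l) (hB : B ∈ soD l) :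
    A * B - B * A ∈ soD l := by
  rw [mem_soD_iff] at *
  rw [Matrix.transpose_sub, Matrix.transpose_mul, Matrix.transpose_mul, sub_mul, mul_assoc, hA,
    mul_neg, ← mul_assoc, hB, mul_assoc, hB, mul_neg, ← mul_assoc, hA, mul_sub]
  simp only [neg_mul, mul_assoc]
  abel

/-- The involutive automorphism `Y ↦ -J Yᵀ J` of the Lie algebra of all matrices, whose fixed
points form `so_{2|l|}(ℂ)`. -/
def skewInvolution (Y : Mat l) : Mat l :=
  -(LieAlgebra.Orthogonal.JD l ℂ * Y.transpose * LieAlgebra.Orthogonal.JD l ℂ)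

lemma mem_soD_iff_skewInvolution {A : Mat l} : A ∈ soD l ↔ skewInvolution A = A := by
  rw [mem_soD_iff, skewInvolution, mul_assoc]
  constructor
  · intro h
    rw [h, mul_neg, neg_neg, ← mul_assoc, JD_mul_self, one_mul]
  · intro h
    rw [← neg_eq_iff_eq_neg] at *
    nth_rewrite 2 [← h]
    rw [mul_neg, ← mul_assoc, JD_mul_self, one_mul]

lemma skewInvolution_commutator (A B : Mat l) :
    skewInvolution (A * B - B * A) =
      skewInvolution A * skewInvolution B - skewInvolution B * skewInvolution A := by
  have h (Y : Mat l) : LieAlgebra.Orthogonal.JD l ℂ * (LieAlgebra.Orthogonal.JD l ℂ * Y) = Y := by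
    rw [← mul_assoc, JD_mul_self, one_mul]
  simp only [skewInvolution, Matrix.transpose_sub, Matrix.transpose_mul, mul_sub, sub_mul, neg_mul,
    mul_neg, neg_neg, mul_assoc, h]
  abel

lemma skewInvolution_smul (c : ℂ) (A : Mat l) : skewInvolution (c • A) = c • skewInvolution A := by
  simp [skewInvolution]

lemma skewInvolution_skewInvolution (A : Mat l) : skewInvolution (skewInvolution A) = A := by
  have h (Y : Mat l) : LieAlgebra.Orthogonal.JD l ℂ * (LieAlgebra.Orthogonal.JD l ℂ * Y) = Y := by
    rw [← mul_assoc, JD_mul_self, one_mul]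
  simp [skewInvolution, Matrix.transpose_mul, JD_transpose, mul_assoc, JD_mul_self, h]

lemma half_add_skewInvolution_mem_soD (A : Mat l) :
    (1 / 2 : ℂ) • (A + skewInvolution A) ∈ soD l := by
  refine Submodule.smul_mem _ _ ?_
  rw [mem_soD_iff_skewInvolution]
  have h (A B : Mat l) : skewInvolution (A + B) = skewInvolution A + skewInvolution B := by
    simp [skewInvolution, mul_add, add_mul, add_comm]
  rw [h, skewInvolution_skewInvolution, add_comm]

lemma trace_skewInvolution_mul (A : Mat l) {B : Mat l} (hB : B ∈ soD l) :
    (skewInvolution A * B).trace = (A * B).trace := by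
  rw [mem_soD_iff_skewInvolution] at hB
  nth_rewrite 1 [← hB]
  have h (Y : Mat l) : LieAlgebra.Orthogonal.JD l ℂ * (LieAlgebra.Orthogonal.JD l ℂ * Y) = Y := by
    rw [← mul_assoc, JD_mul_self, one_mul]
  simp only [skewInvolution, neg_mul, mul_neg, neg_neg, mul_assoc, h]
  rw [Matrix.trace_mul_comm, mul_assoc, mul_assoc, JD_mul_self, mul_one, ← Matrix.transpose_mul,
    Matrix.trace_transpose, Matrix.trace_mul_comm]

/-- The trace form is nondegenerate on `so_{2|l|}(ℂ)`. -/
lemma eq_zero_of_trace_mul_eq_zero {A : Mat l} (hA : A ∈ soD l)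
    (h : ∀ B ∈ soD l, (A * B).trace = 0) : A = 0 := by
  refine Matrix.ext fun i j => ?_
  have h1 := h _ (half_add_skewInvolution_mem_soD (Matrix.single j i 1))
  rw [mul_smul_comm, Matrix.trace_smul, mul_add, Matrix.trace_add,
    Matrix.trace_mul_comm A (skewInvolution _), trace_skewInvolution_mul _ hA,
    Matrix.trace_mul_comm A] at h1
  have h2 : (Matrix.single j i 1 * A).trace = A i j := by
    simp [Matrix.trace_single_mul]
  rw [h2, smul_eq_mul] at h1
  simpa using (by linear_combination h1 : A i j = 0)

/-- The element `v ↦ (y, v) x - (x, v) y` of `so_{2|l|}(ℂ)`. -/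
def wedge (x y : l ⊕ l → ℂ) : Mat l :=
  (Matrix.vecMulVec x y - Matrix.vecMulVec y x) * LieAlgebra.Orthogonal.JD l ℂ

lemma wedge_mulVec (x y v : l ⊕ l → ℂ) :
    (wedge x y).mulVec v = form l y v • x - form l x v • y := by
  rw [wedge, ← Matrix.mulVec_mulVec, Matrix.sub_mulVec, Matrix.vecMulVec_mulVec,
    Matrix.vecMulVec_mulVec, form_eq_dotProduct, form_eq_dotProduct]
  simp

lemma wedge_mem_soD (x y : l ⊕ l → ℂ) : wedge x y ∈ soD l := by
  rw [mem_soD_iff, wedge, Matrix.transpose_mul, JD_transpose, Matrix.transpose_sub,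
    Matrix.transpose_vecMulVec, Matrix.transpose_vecMulVec, mul_assoc, ← mul_neg, ← neg_mul,
    neg_sub]

lemma trace_mul_wedge {c : Mat l} (hc : c ∈ soD l) (x y : l ⊕ l → ℂ) :
    (c * wedge x y).trace = -2 * form l x (c.mulVec y) := by
  have h (x y : l ⊕ l → ℂ) : (c * (Matrix.vecMulVec x y * LieAlgebra.Orthogonal.JD l ℂ)).trace =
      form l y (c.mulVec x) := by
    rw [Matrix.vecMulVec_mul, Matrix.mul_vecMulVec, Matrix.trace_vecMulVec, dotProduct_comm,
      ← Matrix.dotProduct_mulVec, form_eq_dotProduct]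
  rw [wedge, sub_mul, mul_sub, Matrix.trace_sub, h, h, form_comm y, form_mulVec_of_mem_soD hc]
  ring

end Form

/-! ### The tangent space to the adjoint orbit -/

section Orbit

variable {l : Type} [Fintype l] [DecidableEq l]

omit [DecidableEq l] in
lemma hasDerivAt_mul_apply {f g : ℂ → Mat l} {f' g' : Mat l}
    (hf : ∀ i j, HasDerivAt (fun t => f t i j) (f' i j) 0)
    (hg : ∀ i j, HasDerivAt (fun t => g t i j) (g' i j) 0) (i j : l ⊕ l) :
    HasDerivAt (fun t => (f t * g t) i j) ((f' * g 0 + f 0 * g') i j) 0 := by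
  simp only [Matrix.mul_apply, Matrix.add_apply, ← Finset.sum_add_distrib]
  exact HasDerivAt.fun_sum fun k _ => (hf i k).mul (hg k j)

omit [DecidableEq l] in
lemma hasDerivAt_const_mul_apply {g : ℂ → Mat l} {g' : Mat l} (A : Mat l)
    (hg : ∀ i j, HasDerivAt (fun t => g t i j) (g' i j) 0) (i j : l ⊕ l) :
    HasDerivAt (fun t => (A * g t) i j) ((A * g') i j) 0 := by
  have h := hasDerivAt_mul_apply (f := fun _ => A) (f' := 0)
    (fun i j => by simpa using hasDerivAt_const (0 : ℂ) (A i j)) hg i j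
  simpa using h

omit [DecidableEq l] in
lemma hasDerivAt_mul_const_apply {f : ℂ → Mat l} {f' : Mat l} (A : Mat l)
    (hf : ∀ i j, HasDerivAt (fun t => f t i j) (f' i j) 0) (i j : l ⊕ l) :
    HasDerivAt (fun t => (f t * A) i j) ((f' * A) i j) 0 := by
  have h := hasDerivAt_mul_apply (g := fun _ => A) (g' := 0) hf
    (fun i j => by simpa using hasDerivAt_const (0 : ℂ) (A i j)) i j
  simpa using h

lemma inv_eq_of_mem_specialOrthogonalD {g : Mat l} (hg : g ∈ specialOrthogonalD l) :
    g⁻¹ = LieAlgebra.Orthogonal.JD l ℂ * g.transpose * LieAlgebra.Orthogonal.JD l ℂ := by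
  apply Matrix.inv_eq_left_inv
  rw [mul_assoc, mul_assoc, ← mul_assoc g.transpose, hg.1, JD_mul_self]

/-- The velocity at `g(0) = 1` of a curve in the group lies in the Lie algebra, and conjugating
`X` by the curve moves it with velocity `[g'(0), X]`. -/
lemma velocity_eq_commutator {g : ℂ → Mat l} (hg : ∀ t, g t ∈ specialOrthogonalD l)
    (h0 : g 0 = 1) {Z : Mat l} (hZ : ∀ i j, HasDerivAt (fun t => g t i j) (Z i j) 0) (X : Mat l) :
    Z ∈ soD l ∧
      ∀ i j, HasDerivAt (fun t => (g t * X * (g t)⁻¹) i j) ((Z * X - X * Z) i j) 0 := by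
  have hT : ∀ i j, HasDerivAt (fun t => (g t).transpose i j) (Z.transpose i j) 0 :=
    fun i j => hZ j i
  have hso : Z ∈ soD l := by
    rw [mem_soD_iff, eq_neg_iff_add_eq_zero]
    refine Matrix.ext fun i j => ?_
    have h1 := hasDerivAt_mul_apply
      (hasDerivAt_mul_const_apply (LieAlgebra.Orthogonal.JD l ℂ) hT) hZ i j
    simp only [(hg _).1, h0, Matrix.transpose_one, mul_one, one_mul] at h1
    exact h1.unique (hasDerivAt_const _ _)
  refine ⟨hso, fun i j => ?_⟩
  have h1 := hasDerivAt_mul_apply (hasDerivAt_mul_const_apply X hZ)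
    (hasDerivAt_mul_const_apply (LieAlgebra.Orthogonal.JD l ℂ)
      (hasDerivAt_const_mul_apply (LieAlgebra.Orthogonal.JD l ℂ) hT)) i j
  have h2 : LieAlgebra.Orthogonal.JD l ℂ * Z.transpose * LieAlgebra.Orthogonal.JD l ℂ = -Z :=
    neg_eq_iff_eq_neg.1 (mem_soD_iff_skewInvolution.1 hso)
  simp only [h0, h2, Matrix.transpose_one, mul_one, one_mul, JD_mul_self] at h1
  simpa [inv_eq_of_mem_specialOrthogonalD (hg _), sub_eq_add_neg] using h1

open scoped Matrix.Norms.Operator in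
lemma hasDerivAt_exp_smul_apply (Z : Mat l) (t : ℂ) (i j : l ⊕ l) :
    HasDerivAt (fun t : ℂ => NormedSpace.exp (t • Z) i j) ((NormedSpace.exp (t • Z) * Z) i j) t :=
  ((Matrix.entryLinearMap ℂ ℂ i j).toContinuousLinearMap.hasFDerivAt.comp_hasDerivAt t
    (hasDerivAt_exp_smul_const Z t))

lemma exp_smul_mem_specialOrthogonalD {Z : Mat l} (hZ : Z ∈ soD l) (t : ℂ) :
    NormedSpace.exp (t • Z) ∈ specialOrthogonalD l := by
  have hJ : IsUnit (LieAlgebra.Orthogonal.JD l ℂ) := IsUnit.of_mul_eq_one _ JD_mul_self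
  have hJinv : (LieAlgebra.Orthogonal.JD l ℂ)⁻¹ = LieAlgebra.Orthogonal.JD l ℂ :=
    Matrix.inv_eq_left_inv JD_mul_self
  have key (t : ℂ) : (NormedSpace.exp (t • Z)).transpose * LieAlgebra.Orthogonal.JD l ℂ *
      NormedSpace.exp (t • Z) = LieAlgebra.Orthogonal.JD l ℂ := by
    have h1 : (t • Z).transpose =
        LieAlgebra.Orthogonal.JD l ℂ * (-(t • Z)) * (LieAlgebra.Orthogonal.JD l ℂ)⁻¹ := by
      have h2 := mem_soD_iff.1 (Submodule.smul_mem _ t hZ)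
      rw [mul_neg, ← h2, hJinv, mul_assoc, JD_mul_self, mul_one]
    have h2 : (NormedSpace.exp (t • Z)).transpose = LieAlgebra.Orthogonal.JD l ℂ *
        (NormedSpace.exp (t • Z))⁻¹ * (LieAlgebra.Orthogonal.JD l ℂ)⁻¹ := by
      have h3 : NormedSpace.exp (-(t • Z)) = (NormedSpace.exp (t • Z))⁻¹ := Matrix.exp_neg (t • Z)
      have h4 : NormedSpace.exp (t • Z).transpose = (NormedSpace.exp (t • Z)).transpose :=
        Matrix.exp_transpose (t • Z)
      rw [← h4, ← h3, h1]
      exact Matrix.exp_conj _ (-(t • Z)) hJ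
    have h5 : IsUnit (NormedSpace.exp (t • Z)).det :=
      (Matrix.isUnit_iff_isUnit_det _).1 (Matrix.isUnit_exp (t • Z))
    rw [h2, hJinv, mul_assoc, mul_assoc, ← mul_assoc (LieAlgebra.Orthogonal.JD l ℂ)
      (LieAlgebra.Orthogonal.JD l ℂ), JD_mul_self, one_mul, mul_assoc, Matrix.nonsing_inv_mul _ h5,
      mul_one]
  refine ⟨key t, ?_⟩
  -- The determinant of an orthogonal matrix is `±1`, and `exp (tZ)` is a square of such a matrix.
  have h1 : NormedSpace.exp (t • Z) =
      NormedSpace.exp ((t / 2) • Z) * NormedSpace.exp ((t / 2) • Z) := by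
    have h2 := Matrix.exp_add_of_commute ((t / 2) • Z) ((t / 2) • Z) (Commute.refl _)
    rwa [← add_smul, add_halves] at h2
  have h2 := congrArg Matrix.det (key (t / 2))
  have h3 : (LieAlgebra.Orthogonal.JD l ℂ).det ≠ 0 :=
    ((Matrix.isUnit_iff_isUnit_det _).1 hJ).ne_zero
  rw [Matrix.det_mul, Matrix.det_mul, Matrix.det_transpose] at h2
  rw [h1, Matrix.det_mul]
  exact mul_right_cancel₀ h3 (by linear_combination h2)

/-- The tangent space at `X` to its adjoint orbit is `[so_{2|l|}(ℂ), X]`. -/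
lemma mem_orbitTangentSpace_iff {X v : Mat l} :
    v ∈ orbitTangentSpace X ↔ ∃ Z ∈ soD l, v = Z * X - X * Z := by
  constructor
  · intro hv
    have hle : orbitTangentSpace X ≤
        (soD l).map (LinearMap.mulRight ℂ X - LinearMap.mulLeft ℂ X) := by
      refine Submodule.span_le.2 ?_
      rintro v ⟨g, hg, h0, hd, hv⟩
      obtain ⟨hZ, hZv⟩ := velocity_eq_commutator hg h0
        (Z := Matrix.of fun i j => deriv (fun t => g t i j) 0)
        (fun i j => (hd i j 0).hasDerivAt) X
      exact ⟨_, hZ, Matrix.ext fun i j => (hZv i j).unique (hv i j)⟩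
    obtain ⟨Z, hZ, h⟩ := hle hv
    exact ⟨Z, hZ, h.symm⟩
  · rintro ⟨Z, hZ, rfl⟩
    refine Submodule.subset_span ⟨fun t => NormedSpace.exp (t • Z),
      exp_smul_mem_specialOrthogonalD hZ, by simp,
      fun i j t => (hasDerivAt_exp_smul_apply Z t i j).differentiableAt, ?_⟩
    exact (velocity_eq_commutator (exp_smul_mem_specialOrthogonalD hZ) (by simp)
      (fun i j => by simpa using hasDerivAt_exp_smul_apply Z 0 i j) X).2

/-- The duality behind transversality: the orthogonal complement of `[so, X]` for the trace form
is the centralizer of `X`, so `[so, X]` and `D` span `so` as soon as no nonzero element of the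
centralizer is orthogonal to `D`. -/
lemma orbitTangentSpace_sup_eq_soD {X : Mat l} (hX : X ∈ soD l) {D : Submodule ℂ (Mat l)}
    (hD : D ≤ soD l)
    (h : ∀ c ∈ soD l, Commute c X → (∀ s ∈ D, (c * s).trace = 0) → c = 0) :
    orbitTangentSpace X ⊔ D = soD l := by
  have hle : orbitTangentSpace X ⊔ D ≤ soD l := by
    refine sup_le (fun v hv => ?_) hD
    obtain ⟨Z, hZ, rfl⟩ := mem_orbitTangentSpace_iff.1 hv
    exact commutator_mem_soD hZ hX
  refine le_antisymm hle fun Y hY => by_contra fun hYn => ?_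
  obtain ⟨φ, hφY, hφ⟩ := Submodule.exists_dual_map_eq_bot_of_notMem hYn inferInstance
  have hφ0 : ∀ s ∈ orbitTangentSpace X ⊔ D, φ s = 0 := fun s hs => by
    have := Submodule.mem_map_of_mem (f := φ) hs
    rwa [hφ, Submodule.mem_bot] at this
  -- `φ` is the pairing with `c₀`, and on `so` it is the pairing with the projection `c` of `c₀`.
  set c₀ : Mat l := Matrix.of fun i j => φ (Matrix.single j i 1)
  have hc₀ (s : Mat l) : φ s = (c₀ * s).trace := by
    conv_lhs => rw [Matrix.matrix_eq_sum_single s]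
    simp only [map_sum, Matrix.trace, Matrix.diag_apply, Matrix.mul_apply]
    rw [Finset.sum_comm]
    refine Finset.sum_congr rfl fun j _ => Finset.sum_congr rfl fun i _ => ?_
    rw [← mul_one (s i j), ← smul_eq_mul (s i j), ← Matrix.smul_single, map_smul]
    simp [c₀, mul_comm]
  set c : Mat l := (1 / 2 : ℂ) • (c₀ + skewInvolution c₀)
  have hcso : c ∈ soD l := half_add_skewInvolution_mem_soD c₀
  have hc (s : Mat l) (hs : s ∈ soD l) : (c * s).trace = φ s := by
    rw [hc₀, smul_mul_assoc, Matrix.trace_smul, add_mul, Matrix.trace_add,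
      trace_skewInvolution_mul _ hs, smul_eq_mul]
    ring
  have hcomm : X * c - c * X = 0 := by
    refine eq_zero_of_trace_mul_eq_zero (commutator_mem_soD hX hcso) fun Z hZ => ?_
    have h1 := hc _ (commutator_mem_soD hZ hX)
    rw [hφ0 _ (Submodule.mem_sup_left (mem_orbitTangentSpace_iff.2 ⟨Z, hZ, rfl⟩))] at h1
    rw [← h1, sub_mul, mul_sub, Matrix.trace_sub, Matrix.trace_sub, mul_assoc,
      Matrix.trace_mul_comm, mul_assoc, mul_assoc]
  have hc0 : c = 0 := h c hcso (sub_eq_zero.1 hcomm).symm fun s hs => by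
    rw [hc s (hD hs), hφ0 s (Submodule.mem_sup_right hs)]
  apply hφY
  rw [← hc Y hY, hc0, zero_mul, Matrix.trace_zero]

end Orbit

/-! ### Jordan blocks and the irreducible representations of `sl₂` -/

section JordanBlocks

lemma jordanBlock_mul_apply {s : ℕ} {κ : Type} (M : Matrix (Fin s) κ ℂ) (i : Fin s) (j : κ) :
    (jordanBlock s * M) i j = if h : (i : ℕ) + 1 < s then M ⟨i + 1, h⟩ j else 0 := by
  simp only [jordanBlock, Matrix.mul_apply, Matrix.of_apply, ite_mul, one_mul, zero_mul]
  split_ifs with h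
  · rw [Finset.sum_eq_single ⟨(i : ℕ) + 1, h⟩]
    · simp
    · intro k _ hk
      exact if_neg fun h' => hk (Fin.ext h'.symm)
    · simp
  · exact Finset.sum_eq_zero fun k _ => if_neg (by have := k.2; omega)

lemma mul_jordanBlock_apply {s : ℕ} {κ : Type} (M : Matrix κ (Fin s) ℂ) (i : κ) (j : Fin s) :
    (M * jordanBlock s) i j = if 0 < (j : ℕ) then M i ⟨j - 1, by omega⟩ else 0 := by
  simp only [jordanBlock, Matrix.mul_apply, Matrix.of_apply, mul_ite, mul_one, mul_zero]
  split_ifs with h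
  · rw [Finset.sum_eq_single ⟨(j : ℕ) - 1, by omega⟩]
    · exact if_pos (by simp only; omega)
    · intro k _ hk
      exact if_neg fun h' => hk (Fin.ext (by simp only; omega))
    · simp
  · exact Finset.sum_eq_zero fun k _ => if_neg (by omega)

/-- The weights `s - 1, s - 3, …, 1 - s` of the irreducible `sl₂`-module of dimension `s`. -/
def weightBlock (s : ℕ) : Matrix (Fin s) (Fin s) ℂ :=
  Matrix.diagonal fun k => (s : ℂ) - 1 - 2 * (k : ℕ)

/-- The action of the lowering element on the irreducible `sl₂`-module of dimension `s`, in the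
weight basis in which the raising element is a Jordan block. -/
def lowerBlock (s : ℕ) : Matrix (Fin s) (Fin s) ℂ :=
  Matrix.of fun i j => if (j : ℕ) + 1 = i then ((j : ℕ) + 1) * ((s : ℂ) - 1 - (j : ℕ)) else 0

lemma jordanBlock_lowerBlock_commutator (s : ℕ) :
    jordanBlock s * lowerBlock s - lowerBlock s * jordanBlock s = weightBlock s := by
  ext i j
  rw [Matrix.sub_apply, jordanBlock_mul_apply, mul_jordanBlock_apply]
  simp only [lowerBlock, weightBlock, Matrix.of_apply, Matrix.diagonal_apply]
  rcases eq_or_ne i j with rfl | hij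
  · have h1 : (if h : (i : ℕ) + 1 < s then if (i : ℕ) + 1 = (i : ℕ) + 1 then
        ((i : ℕ) + 1) * ((s : ℂ) - 1 - (i : ℕ)) else 0 else 0) =
        ((i : ℕ) + 1) * ((s : ℂ) - 1 - (i : ℕ)) := by
      rw [if_pos rfl]
      split_ifs with h
      · rfl
      · have h2 : s = (i : ℕ) + 1 := by omega
        have h3 : (s : ℂ) = (i : ℕ) + 1 := by exact_mod_cast h2
        linear_combination (-((i : ℕ) : ℂ) - 1) * h3
    have h4 : (if 0 < (i : ℕ) then if (i : ℕ) - 1 + 1 = i then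
        (((i : ℕ) - 1 : ℕ) + 1) * ((s : ℂ) - 1 - ((i : ℕ) - 1 : ℕ)) else 0 else 0) =
        (i : ℕ) * ((s : ℂ) - (i : ℕ)) := by
      split_ifs with h h'
      · rw [Nat.cast_sub (by omega)]
        push_cast
        ring
      · omega
      · have h2 : (i : ℕ) = 0 := by omega
        simp [h2]
    rw [h1, h4, if_pos rfl]
    ring
  · have h0 : (i : ℕ) ≠ j := fun h => hij (Fin.ext h)
    rw [if_neg hij]
    have h1 : ¬ (j : ℕ) + 1 = (i : ℕ) + 1 := by omega
    simp only [h1, if_false]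
    split_ifs with h2 h3 h4
    all_goals first | omega | simp

lemma weightBlock_lowerBlock_commutator (s : ℕ) :
    weightBlock s * lowerBlock s - lowerBlock s * weightBlock s = (-2 : ℂ) • lowerBlock s := by
  ext i j
  simp only [weightBlock, lowerBlock, Matrix.sub_apply, Matrix.diagonal_mul, Matrix.mul_diagonal,
    Matrix.of_apply, Matrix.smul_apply, smul_eq_mul]
  split_ifs with h
  · rw [← h]
    push_cast
    ring
  · simp

end JordanBlocks

/-! ### Nilpotent matrices generated by two chains -/

section Chains

variable {ι : Type} [Fintype ι] [DecidableEq ι]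

/-- The matrix with columns `X ^ (a - 1) u, …, X u, u` and `X ^ (b - 1) w, …, X w, w`. -/
def chainMatrix (X : Matrix ι ι ℂ) (a b : ℕ) (u w : ι → ℂ) : Matrix ι (Fin a ⊕ Fin b) ℂ :=
  Matrix.of fun i => Sum.elim (fun k => (X ^ (a - 1 - k)).mulVec u i)
    fun k => (X ^ (b - 1 - k)).mulVec w i

variable {X : Matrix ι ι ℂ} {a b : ℕ} {u w : ι → ℂ}

lemma mul_chainMatrix (hu : (X ^ a).mulVec u = 0) (hw : (X ^ b).mulVec w = 0) :
    X * chainMatrix X a b u w =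
      chainMatrix X a b u w * Matrix.fromBlocks (jordanBlock a) 0 0 (jordanBlock b) := by
  have hcol (κ : Type) [Fintype κ] [DecidableEq κ] (M : Matrix ι κ ℂ) (i : ι) (k : κ) :
      (X * M) i k = X.mulVec (fun i => M i k) i := rfl
  have hblock (s : ℕ) (v : ι → ℂ) (hv : (X ^ s).mulVec v = 0) (i : ι) (k : Fin s) :
      X.mulVec ((X ^ (s - 1 - k)).mulVec v) i =
        ((Matrix.of fun i (k : Fin s) => (X ^ (s - 1 - k)).mulVec v i) * jordanBlock s) i k := by
    rw [mul_jordanBlock_apply, Matrix.mulVec_mulVec, ← pow_succ']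
    have hk := k.2
    split_ifs with h
    · rw [Matrix.of_apply]
      congr 3
      simp only
      omega
    · rw [show s - 1 - k + 1 = s by omega, hv, Pi.zero_apply]
  ext i (k | k)
  · rw [hcol]
    simp only [chainMatrix, Matrix.of_apply, Sum.elim_inl]
    rw [hblock a u hu]
    simp [Matrix.mul_apply, Fintype.sum_sum_type]
  · rw [hcol]
    simp only [chainMatrix, Matrix.of_apply, Sum.elim_inr]
    rw [hblock b w hw]
    simp [Matrix.mul_apply, Fintype.sum_sum_type]

/-- If `u` and `w` generate the whole space under `X`, then their chains form a basis, by
dimension. -/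
lemma exists_inverse_chainMatrix (hcard : Fintype.card ι = a + b)
    (hu : (X ^ a).mulVec u = 0) (hw : (X ^ b).mulVec w = 0)
    (hgen : ∀ N : Submodule ℂ (ι → ℂ), (∀ v ∈ N, X.mulVec v ∈ N) → u ∈ N → w ∈ N → N = ⊤) :
    ∃ Q : Matrix (Fin a ⊕ Fin b) ι ℂ,
      chainMatrix X a b u w * Q = 1 ∧ Q * chainMatrix X a b u w = 1 := by
  set P := chainMatrix X a b u w with hP
  have hlast (s : ℕ) (v : ι → ℂ) (hv : (X ^ s).mulVec v = 0) (h0 : ¬ 0 < s) : v = 0 := by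
    obtain rfl : s = 0 := by omega
    simpa using hv
  have hsurj : LinearMap.range P.mulVecLin = ⊤ := by
    refine hgen _ ?_ ?_ ?_
    · rintro _ ⟨v, rfl⟩
      refine ⟨(Matrix.fromBlocks (jordanBlock a) 0 0 (jordanBlock b)).mulVec v, ?_⟩
      simp only [Matrix.mulVecLin_apply, Matrix.mulVec_mulVec]
      rw [hP, mul_chainMatrix hu hw]
    · by_cases h : 0 < a
      · refine ⟨Pi.single (Sum.inl ⟨a - 1, by omega⟩) 1, ?_⟩
        ext i
        simp [hP, chainMatrix]
      · rw [hlast a u hu h]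
        exact Submodule.zero_mem _
    · by_cases h : 0 < b
      · refine ⟨Pi.single (Sum.inr ⟨b - 1, by omega⟩) 1, ?_⟩
        ext i
        simp [hP, chainMatrix]
      · rw [hlast b w hw h]
        exact Submodule.zero_mem _
  obtain ⟨Q, hQ⟩ := Matrix.mulVec_surjective_iff_exists_right_inverse.1
    (LinearMap.range_eq_top.1 hsurj)
  exact ⟨Q, hQ, (Matrix.mul_eq_one_comm_of_card_eq _ _ _ (by simp [hcard])).1 hQ⟩

lemma hasNilpotentJordanType_of_chains (hcard : Fintype.card ι = a + b)
    (hu : (X ^ a).mulVec u = 0) (hw : (X ^ b).mulVec w = 0)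
    (hgen : ∀ N : Submodule ℂ (ι → ℂ), (∀ v ∈ N, X.mulVec v ∈ N) → u ∈ N → w ∈ N → N = ⊤) :
    HasNilpotentJordanType X a b := by
  obtain ⟨Q, hPQ, hQP⟩ := exists_inverse_chainMatrix hcard hu hw hgen
  refine ⟨_, Q, hPQ, hQP, ?_⟩
  rw [Matrix.mul_assoc, mul_chainMatrix hu hw, ← Matrix.mul_assoc, hQP, Matrix.one_mul]

lemma weight_mulVec_pow {H : Matrix ι ι ℂ} (hH : H * X - X * H = (2 : ℂ) • X) {c : ℂ}
    (hu : H.mulVec u = c • u) (k : ℕ) :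
    H.mulVec ((X ^ k).mulVec u) = (c + 2 * k) • (X ^ k).mulVec u := by
  induction k with
  | zero => simp [hu]
  | succ k ih =>
    have h : H * X = X * H + (2 : ℂ) • X := by rw [← hH]; abel
    rw [pow_succ', ← Matrix.mulVec_mulVec, Matrix.mulVec_mulVec, h, Matrix.add_mulVec,
      ← Matrix.mulVec_mulVec, ih, Matrix.mulVec_smul, Matrix.smul_mulVec, ← add_smul]
    push_cast
    ring_nf

/-- A weight element `H` with `[H, X] = 2X`, for which the generators of the two chains are
lowest weight vectors, is completed to an `sl₂`-triple of matrices. -/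
lemma exists_lowering_of_chains {H : Matrix ι ι ℂ} (hcard : Fintype.card ι = a + b)
    (hu : (X ^ a).mulVec u = 0) (hw : (X ^ b).mulVec w = 0)
    (hgen : ∀ N : Submodule ℂ (ι → ℂ), (∀ v ∈ N, X.mulVec v ∈ N) → u ∈ N → w ∈ N → N = ⊤)
    (hH : H * X - X * H = (2 : ℂ) • X)
    (hHu : H.mulVec u = (1 - a : ℂ) • u) (hHw : H.mulVec w = (1 - b : ℂ) • w) :
    ∃ N : Matrix ι ι ℂ, H * N - N * H = (-2 : ℂ) • N ∧ X * N - N * X = H := by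
  obtain ⟨Q, hPQ, hQP⟩ := exists_inverse_chainMatrix hcard hu hw hgen
  have hXP := mul_chainMatrix hu hw
  have hweight (s : ℕ) (v : ι → ℂ) (hv : H.mulVec v = (1 - s : ℂ) • v) (k : Fin s) :
      H.mulVec ((X ^ (s - 1 - k)).mulVec v) =
        ((s : ℂ) - 1 - 2 * (k : ℕ)) • (X ^ (s - 1 - k)).mulVec v := by
    rw [weight_mulVec_pow hH hv]
    have hk := k.2
    rw [show s - 1 - (k : ℕ) = s - (1 + k) by omega, Nat.cast_sub (by omega)]
    push_cast
    ring_nf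
  have hHP : H * chainMatrix X a b u w =
      chainMatrix X a b u w * Matrix.fromBlocks (weightBlock a) 0 0 (weightBlock b) := by
    have hcol (κ : Type) [Fintype κ] [DecidableEq κ] (M : Matrix ι κ ℂ) (i : ι) (k : κ) :
        (H * M) i k = H.mulVec (fun i => M i k) i := rfl
    ext i (k | k)
    · rw [hcol]
      simp only [chainMatrix, Matrix.of_apply, Sum.elim_inl]
      rw [hweight a u hHu]
      simp [Matrix.mul_apply, weightBlock, Matrix.diagonal_apply, mul_comm]
    · rw [hcol]
      simp only [chainMatrix, Matrix.of_apply, Sum.elim_inr]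
      rw [hweight b w hHw]
      simp [Matrix.mul_apply, weightBlock, Matrix.diagonal_apply, mul_comm]
  generalize chainMatrix X a b u w = P at *
  -- `X`, `H` and `N` are the conjugates by `P` of the standard triple.
  have hconj {Y Y' : Matrix ι ι ℂ} {B B' : Matrix (Fin a ⊕ Fin b) (Fin a ⊕ Fin b) ℂ}
      (h : Y * P = P * B) (h' : Y' * P = P * B') : (Y * Y') * P = P * (B * B') := by
    rw [Matrix.mul_assoc, h', ← Matrix.mul_assoc, h, Matrix.mul_assoc]
  have hcancel {Y Y' : Matrix ι ι ℂ} (h : Y * P = Y' * P) : Y = Y' := by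
    rw [← Matrix.mul_one Y, ← hPQ, ← Matrix.mul_assoc, h, Matrix.mul_assoc, hPQ, Matrix.mul_one]
  have hNP : (P * Matrix.fromBlocks (lowerBlock a) 0 0 (lowerBlock b) * Q) * P =
      P * Matrix.fromBlocks (lowerBlock a) 0 0 (lowerBlock b) := by
    rw [Matrix.mul_assoc, hQP, Matrix.mul_one]
  refine ⟨P * Matrix.fromBlocks (lowerBlock a) 0 0 (lowerBlock b) * Q, hcancel ?_, hcancel ?_⟩
  · rw [Matrix.sub_mul, hconj hHP hNP, hconj hNP hHP, ← Matrix.mul_sub, Matrix.smul_mul, hNP,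
      ← Matrix.mul_smul]
    congr 1
    rw [Matrix.fromBlocks_multiply, Matrix.fromBlocks_multiply, sub_eq_add_neg,
      Matrix.fromBlocks_neg, Matrix.fromBlocks_add, Matrix.fromBlocks_smul,
      ← weightBlock_lowerBlock_commutator a, ← weightBlock_lowerBlock_commutator b]
    simp [sub_eq_add_neg]
  · rw [Matrix.sub_mul, hconj hXP hNP, hconj hNP hXP, ← Matrix.mul_sub, hHP]
    congr 1
    rw [Matrix.fromBlocks_multiply, Matrix.fromBlocks_multiply, sub_eq_add_neg,
      Matrix.fromBlocks_neg, Matrix.fromBlocks_add,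
      ← jordanBlock_lowerBlock_commutator a, ← jordanBlock_lowerBlock_commutator b]
    simp [sub_eq_add_neg]

end Chains

/-! ### Jacobson-Morozov triples inside `so` -/

section Triple

variable {l : Type} [Fintype l] [DecidableEq l]

/-- If `H` and `X` lie in `so`, then so does the average of `N` and its image under the
involution fixing `so`, and it is still a lowering element. -/
lemma exists_isJMTriple {H X N : Mat l} (hH : H ∈ soD l) (hX : X ∈ soD l)
    (hHX : H * X - X * H = (2 : ℂ) • X) (hHN : H * N - N * H = (-2 : ℂ) • N)
    (hXN : X * N - N * X = H) : ∃ N, IsJMTriple H X N := by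
  have hH' := mem_soD_iff_skewInvolution.1 hH
  have hX' := mem_soD_iff_skewInvolution.1 hX
  have h1 := congrArg skewInvolution hHN
  have h2 := congrArg skewInvolution hXN
  rw [skewInvolution_commutator, hH', skewInvolution_smul] at h1
  rw [skewInvolution_commutator, hX', hH'] at h2
  refine ⟨_, hH, hX, half_add_skewInvolution_mem_soD N, hHX, ?_, ?_⟩
  · have h3 : H * (N + skewInvolution N) - (N + skewInvolution N) * H =
        (-2 : ℂ) • (N + skewInvolution N) := by
      rw [smul_add, ← hHN, ← h1]
      noncomm_ring
    rw [mul_smul_comm, smul_mul_assoc, ← smul_sub, h3, smul_comm]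
  · have h3 : X * (N + skewInvolution N) - (N + skewInvolution N) * X = H + H := by
      nth_rewrite 1 [← hXN]
      rw [← h2]
      noncomm_ring
    rw [mul_smul_comm, smul_mul_assoc, ← smul_sub, h3, ← two_smul ℂ, smul_smul]
    norm_num

end Triple

/-! ### The slice as a sum of wedges -/

section Vectors

/-- The basis vector `e_k` of `ℂ^{2m}`, counted from `1`; zero when `k` is out of range. The basis
of `ℂ^{2m}` is `e_1, …, e_{m-n}, f_1, …, f_n, e*_1, …, e*_{m-n}, f*_1, …, f*_n`, and the form
pairs each `e_k` with `e*_k` and each `f_k` with `f*_k`. -/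
def vecE (m n k : ℕ) : Idx m n ⊕ Idx m n → ℂ :=
  Sum.elim (Sum.elim (fun i => if (i : ℕ) + 1 = k then 1 else 0) 0) 0

/-- The basis vector `f_k` of `ℂ^{2m}`, counted from `1`; zero when `k` is out of range. -/
def vecF (m n k : ℕ) : Idx m n ⊕ Idx m n → ℂ :=
  Sum.elim (Sum.elim 0 (fun i => if (i : ℕ) + 1 = k then 1 else 0)) 0

/-- The vector `u_k`, for `0 ≤ k < m - n`: it is `e*_{k+1}`, except that `u_{m-n-1}` is
`e*_{m-n} + e_{m-n}`. -/
def vecU (m n k : ℕ) : Idx m n ⊕ Idx m n → ℂ :=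
  Sum.elim (Sum.elim (fun i => if (i : ℕ) + 1 = m - n ∧ k + 1 = m - n then 1 else 0) 0)
    (Sum.elim (fun i => if (i : ℕ) = k then 1 else 0) 0)

/-- The vector `w_k`, for `0 ≤ k ≤ n`: it is `f*_{k+1}` for `k < n`, and `w_n = -e_{m-n}`. -/
def vecW (m n k : ℕ) : Idx m n ⊕ Idx m n → ℂ :=
  Sum.elim (Sum.elim (fun i => if (i : ℕ) + 1 = m - n ∧ k = n then -1 else 0) 0)
    (Sum.elim 0 (fun i => if (i : ℕ) = k then 1 else 0))

lemma wedge_apply {l : Type} [Fintype l] [DecidableEq l] (x y : l ⊕ l → ℂ) (i j : l ⊕ l) :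
    wedge x y i j = x i * y j.swap - y i * x j.swap := by
  have h (x y : l ⊕ l → ℂ) : (Matrix.vecMulVec x y * LieAlgebra.Orthogonal.JD l ℂ) i j =
      x i * y j.swap := by
    rcases j with j | j <;>
    simp [Matrix.vecMulVec_mul, Matrix.vecMulVec_apply, Matrix.vecMul, dotProduct,
      LieAlgebra.Orthogonal.JD, Fintype.sum_sum_type, Matrix.one_apply]
  rw [wedge, sub_mul, Matrix.sub_apply, h, h]

/-- The difference between the point of `𝒮_n` with given coordinates and `X_n`, as a sum of
elementary skew-adjoint matrices. -/
def sliceVector (m n : ℕ) (a y : Fin n → ℂ) (z : Fin (n + 1) → ℂ) (d : Fin (m - n - 1) → ℂ) :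
    Mat (Idx m n) :=
  ∑ k ∈ Finset.range (m - n - 1), coord d (m - n - 1 - k) • wedge (vecU m n k) (vecU m n (k + 1)) +
  ∑ k ∈ Finset.range n, coord a (n - k) • wedge (vecW m n k) (vecW m n (k + 1)) +
  ∑ k ∈ Finset.range n, coord y (k + 1) • wedge (vecU m n 0) (vecW m n k) -
  ∑ k ∈ Finset.range (n + 1), coord z (k + 1) • wedge (vecU m n k) (vecW m n n)

lemma coord_of_lt {k : ℕ} (c : Fin k → ℂ) {i : ℕ} (h : k < i) : coord c i = 0 :=
  dif_neg (by omega)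

lemma coord_succ {k : ℕ} (c : Fin k → ℂ) (i : Fin k) : coord c (i + 1) = c i := by
  have := i.2
  simp only [coord]
  rw [dif_pos (by omega)]
  rfl

/-- The entries of a sum of wedges. In the second sum the factors are swapped, so that for the
families of wedges in the slice both sums have the same shape. -/
lemma sum_smul_wedge_apply {l : Type} [Fintype l] [DecidableEq l] (s : Finset ℕ) (c : ℕ → ℂ)
    (x y : ℕ → l ⊕ l → ℂ) (i j : l ⊕ l) :
    (∑ k ∈ s, c k • wedge (x k) (y k)) i j =
      ∑ k ∈ s, c k * (x k i * y k j.swap) - ∑ k ∈ s, c k * (x k j.swap * y k i) := by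
  rw [Matrix.sum_apply, ← Finset.sum_sub_distrib]
  refine Finset.sum_congr rfl fun k _ => ?_
  rw [Matrix.smul_apply, wedge_apply, smul_eq_mul]
  ring

variable {m n q : ℕ}

lemma sum_vecU_mul_vecU (c : ℕ → ℂ) (i j : Idx m n ⊕ Idx m n) :
    ∑ k ∈ Finset.range (m - n - 1), c k * (vecU m n k i * vecU m n (k + 1) j) =
      Sum.elim (fun _ => 0) (Sum.elim (fun i : Fin (m - n) =>
        if (i : ℕ) + 1 < m - n then c i * vecU m n (i + 1) j else 0) fun _ => 0) i := by
  rcases i with (i | i) | (i | i)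
  · refine Finset.sum_eq_zero fun k hk => ?_
    rw [Finset.mem_range] at hk
    have : ¬ k + 1 = m - n := by omega
    simp [vecU, this]
  · simp [vecU]
  · rw [Sum.elim_inr, Sum.elim_inl]
    split_ifs with h
    · rw [Finset.sum_eq_single (i : ℕ)]
      · simp [vecU]
      · intro k _ hk
        simp [vecU, hk.symm]
      · intro h'
        rw [Finset.mem_range] at h'
        omega
    · refine Finset.sum_eq_zero fun k hk => ?_
      rw [Finset.mem_range] at hk
      have : ¬ (i : ℕ) = k := by omega
      simp [vecU, this]
  · simp [vecU]

lemma sum_vecW_mul_vecW (c : ℕ → ℂ) (i j : Idx m n ⊕ Idx m n) :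
    ∑ k ∈ Finset.range n, c k * (vecW m n k i * vecW m n (k + 1) j) =
      Sum.elim (fun _ => 0) (Sum.elim (fun _ => 0) fun i : Fin n =>
        c i * vecW m n (i + 1) j) i := by
  rcases i with (i | i) | (i | i)
  · refine Finset.sum_eq_zero fun k hk => ?_
    rw [Finset.mem_range] at hk
    simp [vecW, hk.ne]
  · simp [vecW]
  · simp [vecW]
  · rw [Sum.elim_inr, Sum.elim_inr, Finset.sum_eq_single (i : ℕ)]
    · simp [vecW]
    · intro k _ hk
      simp [vecW, hk.symm]
    · intro h'
      exact absurd (Finset.mem_range.2 i.2) h'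

lemma sum_vecU_mul_vecW (c : ℕ → ℂ) (i j : Idx m n ⊕ Idx m n) :
    ∑ k ∈ Finset.range n, c k * (vecU m n 0 i * vecW m n k j) =
      Sum.elim (fun _ => 0) (Sum.elim (fun _ => 0) fun j : Fin n => c j * vecU m n 0 i) j := by
  rcases j with (j | j) | (j | j)
  · refine Finset.sum_eq_zero fun k hk => ?_
    rw [Finset.mem_range] at hk
    simp [vecW, hk.ne]
  · simp [vecW]
  · simp [vecW]
  · rw [Sum.elim_inr, Sum.elim_inr, Finset.sum_eq_single (j : ℕ)]
    · simp [vecW]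
    · intro k _ hk
      simp [vecW, hk.symm]
    · intro h'
      exact absurd (Finset.mem_range.2 j.2) h'

lemma sum_vecU_mul_vecW_last (c : ℕ → ℂ) (hn : n + 1 ≤ m - n) (i j : Idx m n ⊕ Idx m n) :
    ∑ k ∈ Finset.range (n + 1), c k * (vecU m n k i * vecW m n n j) =
      Sum.elim (Sum.elim (fun i : Fin (m - n) =>
          if (i : ℕ) + 1 = m - n ∧ n + 1 = m - n then c n * vecW m n n j else 0) fun _ => 0)
        (Sum.elim (fun i : Fin (m - n) => if (i : ℕ) ≤ n then c i * vecW m n n j else 0)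
          fun _ => 0) i := by
  rcases i with (i | i) | (i | i)
  · rw [Sum.elim_inl, Sum.elim_inl]
    split_ifs with h
    · rw [Finset.sum_eq_single n]
      · simp [vecU, h.1, h.2]
      · intro k _ hk
        have : ¬ k + 1 = m - n := by omega
        simp [vecU, this]
      · simp
    · refine Finset.sum_eq_zero fun k hk => ?_
      rw [Finset.mem_range] at hk
      have : ¬ ((i : ℕ) + 1 = m - n ∧ k + 1 = m - n) := by omega
      simp [vecU, this]
  · simp [vecU]
  · rw [Sum.elim_inr, Sum.elim_inl]
    split_ifs with h
    · rw [Finset.sum_eq_single (i : ℕ)]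
      · simp [vecU]
      · intro k _ hk
        simp [vecU, hk.symm]
      · intro h'
        rw [Finset.mem_range] at h'
        omega
    · refine Finset.sum_eq_zero fun k hk => ?_
      rw [Finset.mem_range] at hk
      have : ¬ (i : ℕ) = k := by omega
      simp [vecU, this]
  · simp [vecU]

/-- The identity behind both transversality and the characteristic polynomial: each coordinate of
the slice multiplies a wedge of two vectors of the chains of `X_n`. -/
lemma slicePoint_eq_add_sliceVector (hn : n + 1 ≤ m - n) (a y : Fin n → ℂ) (z : Fin (n + 1) → ℂ)
    (d : Fin (m - n - 1) → ℂ) :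
    slicePoint m n a y z d = nilp m n + sliceVector m n a y z d := by
  rw [slicePoint]
  congr 1
  refine Matrix.ext fun i j => ?_
  rw [sliceVector, Matrix.sub_apply, Matrix.add_apply, Matrix.add_apply]
  simp only [sum_smul_wedge_apply _ _ (vecU m n) fun k => vecU m n (k + 1),
    sum_smul_wedge_apply _ _ (vecW m n) fun k => vecW m n (k + 1),
    sum_smul_wedge_apply _ _ (fun _ => vecU m n 0) (vecW m n),
    sum_smul_wedge_apply _ _ (vecU m n) fun _ => vecW m n n,
    sum_vecU_mul_vecU, sum_vecW_mul_vecW, sum_vecU_mul_vecW, sum_vecU_mul_vecW_last _ hn]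
  rcases i with (i | i) | (i | i) <;> rcases j with (j | j) | (j | j) <;>
  have hi := i.2 <;> have hj := j.2 <;>
  simp [vecU, vecW, matD, matA, matY, matZD, cornerMat]
  all_goals grind [coord_of_lt, coord_succ]

end Vectors

/-! ### The action of `X_n` on the two chains -/

section Nilpotent

variable {m n q : ℕ}

lemma nilp_mem_soD (m n : ℕ) : nilp m n ∈ soD (Idx m n) := by
  have h : (skewCorner (m - n)).transpose = -skewCorner (m - n) := by
    ext i j
    simp only [skewCorner, Matrix.transpose_apply, Matrix.neg_apply, Matrix.of_apply]
    grind
  have h' (j k : ℕ) : (cornerMat j k).transpose = cornerMat k j := by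
    ext s t
    simp [cornerMat, and_comm]
  rw [mem_soD_iff]
  simp [nilp, LieAlgebra.Orthogonal.JD, Matrix.fromBlocks_transpose, Matrix.fromBlocks_multiply,
    h, h', Matrix.fromBlocks_neg]

lemma vecE_succ {k : ℕ} (h : k < m - n) :
    vecE m n (k + 1) = Pi.single (Sum.inl (Sum.inl ⟨k, h⟩)) 1 := by
  ext ((i | i) | (i | i)) <;> simp [vecE, Pi.single_apply, Fin.ext_iff]

lemma vecF_succ {k : ℕ} (h : k < n) :
    vecF m n (k + 1) = Pi.single (Sum.inl (Sum.inr ⟨k, h⟩)) 1 := by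
  ext ((i | i) | (i | i)) <;> simp [vecF, Pi.single_apply, Fin.ext_iff]

lemma vecU_eq {k : ℕ} (h : k < m - n) :
    vecU m n k = Pi.single (Sum.inr (Sum.inl ⟨k, h⟩)) 1 +
      if k + 1 = m - n then Pi.single (Sum.inl (Sum.inl ⟨k, h⟩)) 1 else 0 := by
  ext ((i | i) | (i | i)) <;> split_ifs <;> simp [vecU, Pi.single_apply, Fin.ext_iff] <;> grind

lemma vecW_of_lt {k : ℕ} (h : k < n) :
    vecW m n k = Pi.single (Sum.inr (Sum.inr ⟨k, h⟩)) 1 := by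
  ext ((i | i) | (i | i)) <;> simp [vecW, Pi.single_apply, Fin.ext_iff, h.ne]

lemma vecW_last (m n : ℕ) : vecW m n n = -vecE m n (m - n) := by
  ext ((i | i) | (i | i)) <;> simp [vecW, vecE, i.2.ne]
  split_ifs <;> simp

lemma vecE_zero (m n : ℕ) : vecE m n 0 = 0 := by
  ext ((i | i) | (i | i)) <;> simp [vecE]

lemma vecF_zero (m n : ℕ) : vecF m n 0 = 0 := by
  ext ((i | i) | (i | i)) <;> simp [vecF]

lemma nilp_mulVec_vecE {k : ℕ} (h : k ≤ m - n) :
    (nilp m n).mulVec (vecE m n k) = vecE m n (k - 1) := by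
  rcases k with _ | k
  · rw [vecE_zero, Matrix.mulVec_zero]
  · rw [vecE_succ (by omega), Matrix.mulVec_single_one]
    ext ((i | i) | (i | i)) <;> simp [nilp, vecE, jordanBlock]

lemma nilp_mulVec_vecF {k : ℕ} (h : k ≤ n) :
    (nilp m n).mulVec (vecF m n k) = vecF m n (k - 1) := by
  rcases k with _ | k
  · rw [vecF_zero, Matrix.mulVec_zero]
  · rw [vecF_succ (by omega), Matrix.mulVec_single_one]
    ext ((i | i) | (i | i)) <;> simp [nilp, vecF, jordanBlock]

lemma nilp_mulVec_vecU {k : ℕ} (h : k + 1 < m - n) :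
    (nilp m n).mulVec (vecU m n k) = -vecU m n (k + 1) := by
  rw [vecU_eq (by omega), if_neg h.ne, add_zero, Matrix.mulVec_single_one]
  ext ((i | i) | (i | i)) <;> simp [nilp, vecU, jordanBlock, skewCorner, cornerMat] <;> grind

lemma nilp_mulVec_vecU_last (hp : m - n = q + 1) :
    (nilp m n).mulVec (vecU m n q) = (2 : ℂ) • vecE m n q - vecF m n n := by
  rw [vecU_eq (by omega), if_pos hp.symm, Matrix.mulVec_add, Matrix.mulVec_single_one,
    Matrix.mulVec_single_one]
  ext ((i | i) | (i | i)) <;>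
    simp [nilp, vecE, vecF, jordanBlock, skewCorner, cornerMat, hp] <;> grind

lemma nilp_mulVec_vecW {k : ℕ} (h : k < n) :
    (nilp m n).mulVec (vecW m n k) = -vecW m n (k + 1) := by
  rw [vecW_of_lt h, Matrix.mulVec_single_one]
  ext ((i | i) | (i | i)) <;> simp [nilp, vecW, jordanBlock, cornerMat] <;> grind

lemma nilp_mulVec_vecW_last (m n : ℕ) :
    (nilp m n).mulVec (vecW m n n) = -vecE m n (m - n - 1) := by
  rw [vecW_last, Matrix.mulVec_neg, nilp_mulVec_vecE le_rfl]

lemma form_vecU {k : ℕ} (h : k < m - n) (v : Idx m n ⊕ Idx m n → ℂ) :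
    form _ (vecU m n k) v = v (Sum.inl (Sum.inl ⟨k, h⟩)) +
      if k + 1 = m - n then v (Sum.inr (Sum.inl ⟨k, h⟩)) else 0 := by
  rw [vecU_eq h]
  split_ifs <;> simp

lemma form_vecW_of_lt {k : ℕ} (h : k < n) (v : Idx m n ⊕ Idx m n → ℂ) :
    form _ (vecW m n k) v = v (Sum.inl (Sum.inr ⟨k, h⟩)) := by
  rw [vecW_of_lt h, form_single_inr]

lemma form_vecW_last (hp : m - n = q + 1) (v : Idx m n ⊕ Idx m n → ℂ) :
    form _ (vecW m n n) v = -v (Sum.inr (Sum.inl ⟨q, by omega⟩)) := by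
  rw [vecW_last, (congrArg (vecE m n) hp).trans (vecE_succ (by omega)), map_neg,
    LinearMap.neg_apply, form_single_inl]

lemma form_vecU_vecU (hp : m - n = q + 1) {i j : ℕ} (hi : i ≤ q) :
    form _ (vecU m n i) (vecU m n j) = if i = q ∧ j = q then 2 else 0 := by
  rw [form_vecU (by omega)]
  simp [vecU]
  grind

lemma form_vecU_vecW (hp : m - n = q + 1) {i j : ℕ} (hi : i ≤ q) :
    form _ (vecU m n i) (vecW m n j) = if i = q ∧ j = n then -1 else 0 := by
  rw [form_vecU (by omega)]
  simp [vecW]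
  grind

lemma form_vecW_vecW (hp : m - n = q + 1) {i j : ℕ} (hi : i ≤ n) :
    form _ (vecW m n i) (vecW m n j) = 0 := by
  rcases hi.lt_or_eq with h | rfl
  · rw [form_vecW_of_lt h]
    simp [vecW]
  · rw [form_vecW_last hp]
    simp [vecW]

/-- The subspaces containing `u_0` and `w_0` and stable under `X_n` contain every basis vector. -/
lemma eq_top_of_nilp_invariant (hp : m - n = q + 1)
    {N : Submodule ℂ (Idx m n ⊕ Idx m n → ℂ)} (hN : ∀ v ∈ N, (nilp m n).mulVec v ∈ N)
    (hu : vecU m n 0 ∈ N) (hw : vecW m n 0 ∈ N) : N = ⊤ := by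
  have hU (k : ℕ) (hk : k ≤ q) : vecU m n k ∈ N := by
    induction k with
    | zero => exact hu
    | succ k ih =>
      have := hN _ (ih (by omega))
      rwa [nilp_mulVec_vecU (by omega), neg_mem_iff] at this
  have hW (k : ℕ) (hk : k ≤ n) : vecW m n k ∈ N := by
    induction k with
    | zero => exact hw
    | succ k ih =>
      have := hN _ (ih (by omega))
      rwa [nilp_mulVec_vecW (by omega), neg_mem_iff] at this
  have hE (k : ℕ) (hk : k ≤ q + 1) : vecE m n (q + 1 - k) ∈ N := by
    induction k with
    | zero =>
      have := hW n le_rfl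
      rwa [vecW_last, neg_mem_iff, hp] at this
    | succ k ih =>
      have := hN _ (ih (by omega))
      rwa [nilp_mulVec_vecE (by omega)] at this
  have hF (k : ℕ) (hk : k ≤ n) : vecF m n (n - k) ∈ N := by
    induction k with
    | zero =>
      have h1 := hN _ (hU q le_rfl)
      rw [nilp_mulVec_vecU_last hp] at h1
      have h2 := N.smul_mem 2 (hE 1 (by omega))
      simpa using N.sub_mem h2 h1
    | succ k ih =>
      have := hN _ (ih (by omega))
      rwa [nilp_mulVec_vecF (by omega)] at this
  have hEi (i : Fin (m - n)) : Pi.single (Sum.inl (Sum.inl i)) 1 ∈ N := by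
    have := hE (q - i) (by omega)
    rwa [show q + 1 - (q - i) = i + 1 by omega, vecE_succ i.2] at this
  refine eq_top_iff.2 fun v _ => ?_
  rw [← (Pi.basisFun ℂ (Idx m n ⊕ Idx m n)).sum_repr v]
  refine N.sum_mem fun i _ => N.smul_mem _ ?_
  rw [Pi.basisFun_apply]
  rcases i with (i | i) | (i | i)
  · exact hEi i
  · have := hF (n - 1 - i) (by omega)
    rwa [show n - (n - 1 - i) = i + 1 by omega, vecF_succ i.2] at this
  · have h1 := hU i (by omega)
    rw [vecU_eq i.2] at h1
    split_ifs at h1 with h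
    · simpa using N.sub_mem h1 (hEi i)
    · simpa using h1
  · have := hW i (by omega)
    rwa [vecW_of_lt i.2] at this

end Nilpotent

/-! ### Pairings along the chains and the Jordan type of `X_n` -/

section Moments

lemma form_pow_mulVec {l : Type} [Fintype l] [DecidableEq l] {A : Mat l} (hA : A ∈ soD l) (k : ℕ)
    (x y : l ⊕ l → ℂ) :
    form l ((A ^ k).mulVec x) y = (-1) ^ k * form l x ((A ^ k).mulVec y) := by
  induction k generalizing y with
  | zero => simp
  | succ k ih =>
    rw [pow_succ', ← Matrix.mulVec_mulVec, form_mulVec_of_mem_soD hA, ih, Matrix.mulVec_mulVec,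
      ← pow_succ, ← pow_succ']
    ring

variable {m n q : ℕ}

/-- The power `T^k` of the operator `T = -X_n`, for which `T u_k = u_{k+1}` and
`T w_k = w_{k+1}`. -/
def shift (m n k : ℕ) : Mat (Idx m n) := (-nilp m n) ^ k

lemma shift_zero_mulVec (v : Idx m n ⊕ Idx m n → ℂ) : (shift m n 0).mulVec v = v := by
  simp [shift]

lemma shift_mulVec_shift (i j : ℕ) (v : Idx m n ⊕ Idx m n → ℂ) :
    (shift m n i).mulVec ((shift m n j).mulVec v) = (shift m n (i + j)).mulVec v := by
  rw [Matrix.mulVec_mulVec, shift, shift, shift, pow_add]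

lemma shift_succ_mulVec (k : ℕ) (v : Idx m n ⊕ Idx m n → ℂ) :
    (shift m n (k + 1)).mulVec v = -(nilp m n).mulVec ((shift m n k).mulVec v) := by
  rw [shift, shift, pow_succ', ← Matrix.mulVec_mulVec, Matrix.neg_mulVec]

lemma form_shift (k : ℕ) (x y : Idx m n ⊕ Idx m n → ℂ) :
    form _ ((shift m n k).mulVec x) y = (-1) ^ k * form _ x ((shift m n k).mulVec y) :=
  form_pow_mulVec (Submodule.neg_mem _ (nilp_mem_soD m n)) k x y

lemma shift_mulVec_vecU (hp : m - n = q + 1) {k : ℕ} (hk : k ≤ q) :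
    (shift m n k).mulVec (vecU m n 0) = vecU m n k := by
  induction k with
  | zero => exact shift_zero_mulVec _
  | succ k ih => rw [shift_succ_mulVec, ih (by omega), nilp_mulVec_vecU (by omega), neg_neg]

lemma shift_mulVec_vecW {k : ℕ} (hk : k ≤ n) :
    (shift m n k).mulVec (vecW m n 0) = vecW m n k := by
  induction k with
  | zero => exact shift_zero_mulVec _
  | succ k ih => rw [shift_succ_mulVec, ih (by omega), nilp_mulVec_vecW (by omega), neg_neg]

lemma shift_mulVec_vecU_of_gt (hp : m - n = q + 1) (k : ℕ) :
    (shift m n (q + 1 + k)).mulVec (vecU m n 0) =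
      (-1 : ℂ) ^ (k + 1) • ((2 : ℂ) • vecE m n (q - k) - vecF m n (n - k)) := by
  induction k with
  | zero =>
    rw [add_zero, shift_succ_mulVec, shift_mulVec_vecU hp le_rfl, nilp_mulVec_vecU_last hp]
    simp
  | succ k ih =>
    rw [← add_assoc, shift_succ_mulVec, ih, Matrix.mulVec_smul, Matrix.mulVec_sub,
      Matrix.mulVec_smul, nilp_mulVec_vecE (by omega), nilp_mulVec_vecF (by omega),
      pow_succ _ (k + 1), mul_neg_one, neg_smul, Nat.sub_sub, Nat.sub_sub]

lemma shift_mulVec_vecW_of_gt (hp : m - n = q + 1) (k : ℕ) :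
    (shift m n (n + 1 + k)).mulVec (vecW m n 0) = (-1 : ℂ) ^ k • vecE m n (q - k) := by
  induction k with
  | zero =>
    rw [add_zero, shift_succ_mulVec, shift_mulVec_vecW le_rfl, nilp_mulVec_vecW_last, hp]
    simp
  | succ k ih =>
    rw [← add_assoc, shift_succ_mulVec, ih, Matrix.mulVec_smul, nilp_mulVec_vecE (by omega),
      pow_succ, mul_neg_one, neg_smul, Nat.sub_sub]

lemma shift_mulVec_vecU_eq_zero (hp : m - n = q + 1) (hn : n ≤ q) {k : ℕ} (hk : 2 * q + 1 ≤ k) :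
    (shift m n k).mulVec (vecU m n 0) = 0 := by
  obtain ⟨r, rfl⟩ : ∃ r, k = q + 1 + (q + r) := ⟨k - (2 * q + 1), by omega⟩
  rw [shift_mulVec_vecU_of_gt hp, show q - (q + r) = 0 by omega,
    show n - (q + r) = 0 by omega, vecE_zero, vecF_zero]
  simp

lemma shift_mulVec_vecW_eq (hp : m - n = q + 1) (hn : n ≤ q) {k : ℕ} (hk : 2 * n + 1 ≤ k) :
    (shift m n k).mulVec (vecW m n 0) =
      (-1 / 2 : ℂ) • (shift m n (q - n + k)).mulVec (vecU m n 0) := by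
  obtain ⟨r, rfl⟩ : ∃ r, k = n + 1 + (n + r) := ⟨k - (2 * n + 1), by omega⟩
  rw [shift_mulVec_vecW_of_gt hp, show q - n + (n + 1 + (n + r)) = q + 1 + (n + r) by omega,
    shift_mulVec_vecU_of_gt hp, show n - (n + r) = 0 by omega, vecF_zero, sub_zero, smul_smul,
    smul_smul]
  congr 1
  ring

/-- The vector `w = w_0 + u_{q-n} / 2`, with `q = m - n - 1`, which generates the Jordan block of
size `2n + 1`; it is orthogonal to the chain of `u_0`. -/
def vecW' (m n : ℕ) : Idx m n ⊕ Idx m n → ℂ :=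
  vecW m n 0 + (1 / 2 : ℂ) • vecU m n (m - n - 1 - n)

lemma vecW'_eq (hp : m - n = q + 1) :
    vecW' m n = vecW m n 0 + (1 / 2 : ℂ) • vecU m n (q - n) := by
  rw [vecW', show m - n - 1 - n = q - n by omega]

lemma shift_mulVec_vecW' (hp : m - n = q + 1) (hn : n ≤ q) (k : ℕ) :
    (shift m n k).mulVec (vecW' m n) = (shift m n k).mulVec (vecW m n 0) +
      (1 / 2 : ℂ) • (shift m n (q - n + k)).mulVec (vecU m n 0) := by
  rw [vecW'_eq hp, ← shift_mulVec_vecU hp (by omega), Matrix.mulVec_add,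
    Matrix.mulVec_smul, shift_mulVec_shift, add_comm k]

lemma shift_mulVec_vecW'_eq_zero (hp : m - n = q + 1) (hn : n ≤ q) {k : ℕ} (hk : 2 * n + 1 ≤ k) :
    (shift m n k).mulVec (vecW' m n) = 0 := by
  rw [shift_mulVec_vecW' hp hn, shift_mulVec_vecW_eq hp hn hk, ← add_smul]
  norm_num

lemma form_shift_self_of_odd {k : ℕ} (hk : Odd k) (x : Idx m n ⊕ Idx m n → ℂ) :
    form _ x ((shift m n k).mulVec x) = 0 := by
  have h := form_shift k x x
  rw [hk.neg_one_pow, form_comm] at h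
  linear_combination h / 2

lemma form_shift_add (i j : ℕ) (x y : Idx m n ⊕ Idx m n → ℂ) :
    form _ x ((shift m n (i + j)).mulVec y) =
      (-1) ^ i * form _ ((shift m n i).mulVec x) ((shift m n j).mulVec y) := by
  rw [form_shift, shift_mulVec_shift, ← mul_assoc, ← mul_pow]
  simp

lemma form_vecU_shift_vecU (hp : m - n = q + 1) (hn : n ≤ q) (k : ℕ) :
    form _ (vecU m n 0) ((shift m n k).mulVec (vecU m n 0)) =
      if k = 2 * q then 2 * (-1) ^ q else 0 := by
  rcases le_or_gt k (2 * q) with hk | hk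
  · obtain ⟨i, rfl | rfl⟩ := Nat.even_or_odd' k
    · rw [two_mul i, form_shift_add, shift_mulVec_vecU hp (by omega), form_vecU_vecU hp (by omega)]
      by_cases h : i = q
      · rw [if_pos (by omega), if_pos (by omega), h, mul_comm]
      · rw [if_neg (by omega), if_neg (by omega), mul_zero]
    · rw [form_shift_self_of_odd ⟨i, rfl⟩, if_neg (by omega)]
  · rw [shift_mulVec_vecU_eq_zero hp hn (by omega), map_zero, if_neg (by omega)]

lemma form_vecU_shift_vecW (hp : m - n = q + 1) (hn : n ≤ q) (k : ℕ) :
    form _ (vecU m n 0) ((shift m n k).mulVec (vecW m n 0)) =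
      if k = q + n then -(-1) ^ q else 0 := by
  rcases le_or_gt k (q + n) with hk | hk
  · obtain ⟨i, j, hi, hj, rfl⟩ : ∃ i j, i ≤ q ∧ j ≤ n ∧ k = i + j :=
      ⟨min k q, k - min k q, by omega, by omega, by omega⟩
    rw [form_shift_add, shift_mulVec_vecU hp hi, shift_mulVec_vecW hj, form_vecU_vecW hp hi]
    by_cases h : i = q ∧ j = n
    · rw [if_pos h, if_pos (by omega), h.1]
      ring
    · rw [if_neg h, if_neg (by omega), mul_zero]
  · rw [shift_mulVec_vecW_eq hp hn (by omega), map_smul, form_vecU_shift_vecU hp hn,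
      if_neg (by omega), if_neg (by omega), smul_zero]

lemma form_vecW_shift_vecW (hp : m - n = q + 1) (hn : n ≤ q) (k : ℕ) :
    form _ (vecW m n 0) ((shift m n k).mulVec (vecW m n 0)) = 0 := by
  rcases le_or_gt k (2 * n) with hk | hk
  · obtain ⟨i, rfl | rfl⟩ := Nat.even_or_odd' k
    · rw [two_mul i, form_shift_add, shift_mulVec_vecW (by omega), form_vecW_vecW hp (by omega),
        mul_zero]
    · rw [form_shift_self_of_odd ⟨i, rfl⟩]
  · rw [shift_mulVec_vecW_eq hp hn (by omega), map_smul, form_comm, form_shift,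
      form_vecU_shift_vecW hp hn, if_neg (by omega), mul_zero, smul_zero]

lemma form_vecU_shift_vecW' (hp : m - n = q + 1) (hn : n ≤ q) (k : ℕ) :
    form _ (vecU m n 0) ((shift m n k).mulVec (vecW' m n)) = 0 := by
  rw [shift_mulVec_vecW' hp hn, map_add, map_smul, form_vecU_shift_vecW hp hn,
    form_vecU_shift_vecU hp hn]
  by_cases h : k = q + n
  · rw [if_pos h, if_pos (by omega), smul_eq_mul]
    ring
  · rw [if_neg h, if_neg (by omega), smul_zero, add_zero]

lemma form_vecW'_shift_vecU (hp : m - n = q + 1) (hn : n ≤ q) (k : ℕ) :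
    form _ (vecW' m n) ((shift m n k).mulVec (vecU m n 0)) = 0 := by
  rw [form_comm, form_shift, form_vecU_shift_vecW' hp hn, mul_zero]

lemma form_vecW'_shift_vecW (hp : m - n = q + 1) (hn : n ≤ q) (k : ℕ) :
    form _ (vecW' m n) ((shift m n k).mulVec (vecW m n 0)) =
      if k = 2 * n then -(-1) ^ n / 2 else 0 := by
  have h := form_vecU_shift_vecW hp hn (q - n + k)
  rw [form_shift_add, shift_mulVec_vecU hp (by omega)] at h
  have h1 : form _ (vecU m n (q - n)) ((shift m n k).mulVec (vecW m n 0)) =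
      (-1) ^ (q - n) * if q - n + k = q + n then -(-1) ^ q else 0 := by
    rw [← h, ← mul_assoc, ← mul_pow]
    simp
  rw [vecW'_eq hp, map_add, map_smul, LinearMap.add_apply, LinearMap.smul_apply,
    form_vecW_shift_vecW hp hn, h1, zero_add, smul_eq_mul]
  by_cases hk : k = 2 * n
  · rw [if_pos hk, if_pos (by omega)]
    obtain ⟨r, rfl⟩ : ∃ r, q = n + r := ⟨q - n, by omega⟩
    rw [Nat.add_sub_cancel_left, pow_add, mul_comm ((-1 : ℂ) ^ n)]
    have : (-1 : ℂ) ^ r * (-1) ^ r = 1 := by rw [← mul_pow]; simp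
    linear_combination (-(-1) ^ n / 2) * this
  · rw [if_neg hk, if_neg (by omega)]
    ring

lemma nilp_pow_mulVec (k : ℕ) (v : Idx m n ⊕ Idx m n → ℂ) :
    (nilp m n ^ k).mulVec v = (-1 : ℂ) ^ k • (shift m n k).mulVec v := by
  have h : nilp m n ^ k = (-1 : ℂ) ^ k • shift m n k := by
    rw [shift, ← _root_.smul_pow, neg_one_smul, neg_neg]
  rw [h, Matrix.smul_mulVec]

lemma eq_top_of_nilp_invariant' (hp : m - n = q + 1) (hn : n ≤ q)
    {N : Submodule ℂ (Idx m n ⊕ Idx m n → ℂ)} (hN : ∀ v ∈ N, (nilp m n).mulVec v ∈ N)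
    (hu : vecU m n 0 ∈ N) (hw : vecW' m n ∈ N) : N = ⊤ := by
  have hU (k : ℕ) : (shift m n k).mulVec (vecU m n 0) ∈ N := by
    induction k with
    | zero => rwa [shift_zero_mulVec]
    | succ k ih =>
      rw [shift_succ_mulVec]
      exact N.neg_mem (hN _ ih)
  refine eq_top_of_nilp_invariant hp hN hu ?_
  have h := N.sub_mem hw (N.smul_mem (1 / 2 : ℂ) (hU (q - n)))
  rwa [shift_mulVec_vecU hp (by omega), vecW'_eq hp, add_sub_cancel_right] at h

lemma nilp_pow_mulVec_vecU_zero (hp : m - n = q + 1) (hn : n ≤ q) :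
    (nilp m n ^ (2 * q + 1)).mulVec (vecU m n 0) = 0 := by
  rw [nilp_pow_mulVec, shift_mulVec_vecU_eq_zero hp hn le_rfl, smul_zero]

lemma nilp_pow_mulVec_vecW' (hp : m - n = q + 1) (hn : n ≤ q) :
    (nilp m n ^ (2 * n + 1)).mulVec (vecW' m n) = 0 := by
  rw [nilp_pow_mulVec, shift_mulVec_vecW'_eq_zero hp hn le_rfl, smul_zero]

lemma card_idx_sum (hp : m - n = q + 1) :
    Fintype.card (Idx m n ⊕ Idx m n) = 2 * q + 1 + (2 * n + 1) := by
  simp only [Fintype.card_sum, Fintype.card_fin]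
  omega

lemma nilp_hasNilpotentJordanType (hp : m - n = q + 1) (hn : n ≤ q) :
    HasNilpotentJordanType (nilp m n) (2 * q + 1) (2 * n + 1) :=
  hasNilpotentJordanType_of_chains (card_idx_sum hp) (nilp_pow_mulVec_vecU_zero hp hn)
    (nilp_pow_mulVec_vecW' hp hn) fun _ => eq_top_of_nilp_invariant' hp hn

end Moments

/-! ### The weight grading and `λ`-invariance -/

section LambdaInvariance

variable {m n q : ℕ}

/-- The weights of `H` on `ℂ^{2m}`: `2(m - n - i)` on `e_i`, `2(n + 1 - j)` on `f_j`, and the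
opposite ones on the dual vectors. -/
def weight (m n : ℕ) : Idx m n ⊕ Idx m n → ℤ :=
  Sum.elim
    (Sum.elim (fun i => 2 * (((m - n : ℕ) : ℤ) - 1 - (i : ℕ))) fun j => 2 * ((n : ℤ) - (j : ℕ)))
    (Sum.elim (fun i => -(2 * (((m - n : ℕ) : ℤ) - 1 - (i : ℕ))))
      fun j => -(2 * ((n : ℤ) - (j : ℕ))))

/-- The weight element `H`, in the given basis a diagonal matrix. -/
def weightMat (m n : ℕ) : Mat (Idx m n) := Matrix.diagonal fun i => (weight m n i : ℂ)

lemma weight_swap (i : Idx m n ⊕ Idx m n) : weight m n i.swap = -weight m n i := by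
  rcases i with (i | i) | (i | i) <;> simp [weight]

lemma weightMat_mem_soD (m n : ℕ) : weightMat m n ∈ soD (Idx m n) := by
  rw [mem_soD_iff, weightMat, Matrix.diagonal_transpose]
  ext ((i | i) | (i | i)) ((j | j) | (j | j)) <;>
    simp [Matrix.diagonal_mul, Matrix.mul_diagonal, LieAlgebra.Orthogonal.JD, weight,
      Matrix.one_apply] <;> grind

lemma weight_of_nilp_ne_zero {i j : Idx m n ⊕ Idx m n} (h : nilp m n i j ≠ 0) :
    weight m n i = weight m n j + 2 := by
  revert h
  rcases i with (i | i) | (i | i) <;> rcases j with (j | j) | (j | j) <;>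
    simp [weight, nilp, jordanBlock, skewCorner, cornerMat] <;> grind

lemma weight_of_vecU_ne_zero (hp : m - n = q + 1) {k : ℕ} {i : Idx m n ⊕ Idx m n}
    (h : vecU m n k i ≠ 0) : weight m n i = 2 * (k : ℤ) - 2 * q := by
  revert h
  rcases i with (i | i) | (i | i) <;> simp [weight, vecU] <;> grind

lemma weight_of_vecW_ne_zero {k : ℕ} {i : Idx m n ⊕ Idx m n}
    (h : vecW m n k i ≠ 0) : weight m n i = 2 * (k : ℤ) - 2 * n := by
  revert h
  rcases i with (i | i) | (i | i) <;> simp [weight, vecW] <;> grind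

lemma weightMat_commutator_nilp (m n : ℕ) :
    weightMat m n * nilp m n - nilp m n * weightMat m n = (2 : ℂ) • nilp m n := by
  ext i j
  rw [weightMat, Matrix.sub_apply, Matrix.diagonal_mul, Matrix.mul_diagonal, Matrix.smul_apply,
    smul_eq_mul]
  by_cases h : nilp m n i j = 0
  · simp [h]
  · rw [weight_of_nilp_ne_zero h]
    push_cast
    ring

lemma weightMat_mulVec {v : Idx m n ⊕ Idx m n → ℂ} {c : ℤ} (h : ∀ i, v i ≠ 0 → weight m n i = c) :
    (weightMat m n).mulVec v = (c : ℂ) • v := by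
  ext i
  rw [weightMat, Matrix.mulVec_diagonal, Pi.smul_apply, smul_eq_mul]
  by_cases hi : v i = 0
  · simp [hi]
  · rw [h i hi]

lemma exists_isJMTriple_nilp (hp : m - n = q + 1) (hn : n ≤ q) :
    ∃ N, IsJMTriple (weightMat m n) (nilp m n) N := by
  have hu : (weightMat m n).mulVec (vecU m n 0) = (1 - (2 * q + 1 : ℕ) : ℂ) • vecU m n 0 := by
    rw [weightMat_mulVec fun i => weight_of_vecU_ne_zero hp]
    push_cast
    ring_nf
  have hw : (weightMat m n).mulVec (vecW' m n) = (1 - (2 * n + 1 : ℕ) : ℂ) • vecW' m n := by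
    rw [vecW'_eq hp, Matrix.mulVec_add, Matrix.mulVec_smul,
      weightMat_mulVec fun i => weight_of_vecU_ne_zero hp,
      weightMat_mulVec fun i => weight_of_vecW_ne_zero, smul_add, smul_comm (1 / 2 : ℂ)]
    push_cast [Nat.cast_sub hn]
    ring_nf
  obtain ⟨N, h1, h2⟩ := exists_lowering_of_chains (card_idx_sum hp)
    (nilp_pow_mulVec_vecU_zero hp hn) (nilp_pow_mulVec_vecW' hp hn)
    (fun _ => eq_top_of_nilp_invariant' hp hn) (weightMat_commutator_nilp m n) hu hw
  exact exists_isJMTriple (weightMat_mem_soD m n) (nilp_mem_soD m n)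
    (weightMat_commutator_nilp m n) h1 h2

lemma lam_weightMat_apply (r : ℂ) (Y : Mat (Idx m n)) (i j : Idx m n ⊕ Idx m n) :
    lam (weightMat m n) r Y i j =
      r * Complex.exp (-(Complex.log r / 2) * (weight m n i - weight m n j)) * Y i j := by
  rw [lam, weightMat, ← Matrix.diagonal_smul, ← Matrix.diagonal_smul, Matrix.exp_diagonal,
    Matrix.exp_diagonal, Matrix.smul_apply, Matrix.mul_diagonal, Matrix.diagonal_mul, Pi.coe_exp,
    Pi.coe_exp, ← Complex.exp_eq_exp_ℂ, Pi.smul_apply, Pi.smul_apply, smul_eq_mul, smul_eq_mul,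
    smul_eq_mul, mul_sub, sub_eq_add_neg, Complex.exp_add]
  ring_nf

lemma lam_weightMat_nilp {r : ℂ} (hr : r ≠ 0) : lam (weightMat m n) r (nilp m n) = nilp m n := by
  ext i j
  rw [lam_weightMat_apply]
  by_cases h : nilp m n i j = 0
  · simp [h]
  · have h1 : -(Complex.log r / 2) * ((weight m n i : ℂ) - weight m n j) = -Complex.log r := by
      rw [weight_of_nilp_ne_zero h]
      push_cast
      ring
    rw [h1, Complex.exp_neg, Complex.exp_log hr, mul_inv_cancel₀ hr, one_mul]

lemma lam_weightMat_wedge (r : ℂ) {x y : Idx m n ⊕ Idx m n → ℂ} {b c : ℤ}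
    (hx : ∀ i, x i ≠ 0 → weight m n i = b) (hy : ∀ i, y i ≠ 0 → weight m n i = c) :
    lam (weightMat m n) r (wedge x y) =
      (r * Complex.exp (-(Complex.log r / 2) * (b + c))) • wedge x y := by
  have h (x y : Idx m n ⊕ Idx m n → ℂ) (b c : ℤ) (hx : ∀ i, x i ≠ 0 → weight m n i = b)
      (hy : ∀ i, y i ≠ 0 → weight m n i = c) (i j : Idx m n ⊕ Idx m n) :
      ((weight m n i : ℂ) - weight m n j) = b + c ∨ x i * y j.swap = 0 := by
    by_cases h1 : x i = 0
    · simp [h1]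
    by_cases h2 : y j.swap = 0
    · simp [h2]
    have h3 := hy _ h2
    rw [weight_swap] at h3
    left
    rw [hx _ h1, ← h3]
    push_cast
    ring
  ext i j
  rw [lam_weightMat_apply, Matrix.smul_apply, wedge_apply, smul_eq_mul]
  have h1 : Complex.exp (-(Complex.log r / 2) * (weight m n i - weight m n j)) *
      (x i * y j.swap) = Complex.exp (-(Complex.log r / 2) * (b + c)) * (x i * y j.swap) := by
    rcases h x y b c hx hy i j with h | h <;> simp only [h, mul_zero]
  have h2 : Complex.exp (-(Complex.log r / 2) * (weight m n i - weight m n j)) *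
      (y i * x j.swap) = Complex.exp (-(Complex.log r / 2) * (b + c)) * (y i * x j.swap) := by
    rcases h y x c b hy hx i j with h | h <;> simp only [h, mul_zero, add_comm]
  linear_combination r * h1 - r * h2

lemma exists_coord_eq_mul {k : ℕ} (c : Fin k → ℂ) (μ : ℕ → ℂ) :
    ∃ c' : Fin k → ℂ, ∀ i, coord c' i = μ i * coord c i := by
  refine ⟨fun i => μ (i + 1) * c i, fun i => ?_⟩
  simp only [coord]
  split_ifs with h
  · rw [Nat.sub_add_cancel h.1]
  · rw [mul_zero]

lemma lam_add {l : Type} [Fintype l] [DecidableEq l] (H : Mat l) (r : ℂ) (A B : Mat l) :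
    lam H r (A + B) = lam H r A + lam H r B := by
  simp [lam, mul_add, add_mul]

lemma lam_sub {l : Type} [Fintype l] [DecidableEq l] (H : Mat l) (r : ℂ) (A B : Mat l) :
    lam H r (A - B) = lam H r A - lam H r B := by
  simp [lam, mul_sub, sub_mul, smul_sub]

lemma lam_sum_smul {l : Type} [Fintype l] [DecidableEq l] (H : Mat l) (r : ℂ) (s : Finset ℕ)
    (c : ℕ → ℂ) (A : ℕ → Mat l) :
    lam H r (∑ k ∈ s, c k • A k) = ∑ k ∈ s, c k • lam H r (A k) := by
  simp [lam, Finset.mul_sum, Finset.sum_mul, Finset.smul_sum, smul_comm r]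

/-- Each coordinate of the slice multiplies a wedge of two weight vectors, so `λ_r` rescales it. -/
lemma slice_isLambdaInvariant (hp : m - n = q + 1) (hn : n ≤ q) :
    IsLambdaInvariant (nilp m n) (slice m n) := by
  obtain ⟨N, hN⟩ := exists_isJMTriple_nilp hp hn
  refine ⟨weightMat m n, N, hN, ?_⟩
  rintro r hr _ ⟨a, y, z, d, rfl⟩
  set ε : ℤ → ℂ := fun c => r * Complex.exp (-(Complex.log r / 2) * c) with hε
  have hwedge {x y : Idx m n ⊕ Idx m n → ℂ} {b c : ℤ} (hx : ∀ i, x i ≠ 0 → weight m n i = b)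
      (hy : ∀ i, y i ≠ 0 → weight m n i = c) :
      lam (weightMat m n) r (wedge x y) = ε (b + c) • wedge x y := by
    rw [lam_weightMat_wedge r hx hy, hε]
    push_cast
    rfl
  have hU (k : ℕ) := fun i => weight_of_vecU_ne_zero hp (k := k) (i := i)
  have hW (k : ℕ) := fun i => weight_of_vecW_ne_zero (m := m) (n := n) (k := k) (i := i)
  obtain ⟨a', ha⟩ := exists_coord_eq_mul a fun i =>
    ε (2 * ((n - i : ℕ) : ℤ) - 2 * n + (2 * ((n - i + 1 : ℕ) : ℤ) - 2 * n))
  obtain ⟨y', hy⟩ := exists_coord_eq_mul y fun i =>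
    ε (2 * ((0 : ℕ) : ℤ) - 2 * q + (2 * ((i - 1 : ℕ) : ℤ) - 2 * n))
  obtain ⟨z', hz⟩ := exists_coord_eq_mul z fun i =>
    ε (2 * ((i - 1 : ℕ) : ℤ) - 2 * q + (2 * (n : ℤ) - 2 * n))
  obtain ⟨d', hd⟩ := exists_coord_eq_mul d fun i =>
    ε (2 * ((q - i : ℕ) : ℤ) - 2 * q + (2 * ((q - i + 1 : ℕ) : ℤ) - 2 * q))
  refine ⟨a', y', z', d', ?_⟩
  rw [slicePoint_eq_add_sliceVector (by omega), slicePoint_eq_add_sliceVector (by omega), lam_add,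
    lam_weightMat_nilp hr, sliceVector, sliceVector, lam_sub, lam_add, lam_add]
  simp only [lam_sum_smul]
  congr 1
  congr 1
  · congr 1
    · congr 1
      · refine Finset.sum_congr rfl fun k hk => ?_
        rw [Finset.mem_range] at hk
        rw [hwedge (hU k) (hU (k + 1)), hd, smul_smul, mul_comm,
          show q - (m - n - 1 - k) = k by omega]
      · refine Finset.sum_congr rfl fun k hk => ?_
        rw [Finset.mem_range] at hk
        rw [hwedge (hW k) (hW (k + 1)), ha, smul_smul, mul_comm, show n - (n - k) = k by omega]
    · refine Finset.sum_congr rfl fun k _ => ?_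
      rw [hwedge (hU 0) (hW k), hy, smul_smul, mul_comm, Nat.add_sub_cancel]
  · refine Finset.sum_congr rfl fun k _ => ?_
    rw [hwedge (hU k) (hW n), hz, smul_smul, mul_comm, Nat.add_sub_cancel]

end LambdaInvariance

/-! ### The direction of the slice -/

section Direction

variable {m n q : ℕ}

lemma coord_add {k : ℕ} (c c' : Fin k → ℂ) (i : ℕ) :
    coord (c + c') i = coord c i + coord c' i := by
  simp only [coord]
  split_ifs <;> simp

lemma coord_smul {k : ℕ} (r : ℂ) (c : Fin k → ℂ) (i : ℕ) :
    coord (r • c) i = r * coord c i := by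
  simp only [coord]
  split_ifs <;> simp

lemma coord_zero {k : ℕ} (i : ℕ) : coord (0 : Fin k → ℂ) i = 0 := by
  simp [coord]

lemma coord_single {k : ℕ} (j : Fin k) (i : ℕ) :
    coord (Pi.single j 1) i = if i = j + 1 then 1 else 0 := by
  simp only [coord, Pi.single_apply, Fin.ext_iff]
  have := j.2
  split_ifs <;> first | rfl | omega

/-- The direction of the slice `𝒮_n`. -/
def sliceDirection (m n : ℕ) : Submodule ℂ (Mat (Idx m n)) where
  carrier := {s | ∃ (a y : Fin n → ℂ) (z : Fin (n + 1) → ℂ) (d : Fin (m - n - 1) → ℂ),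
    s = sliceVector m n a y z d}
  zero_mem' := ⟨0, 0, 0, 0, by simp [sliceVector, coord_zero]⟩
  add_mem' := by
    rintro _ _ ⟨a, y, z, d, rfl⟩ ⟨a', y', z', d', rfl⟩
    refine ⟨a + a', y + y', z + z', d + d', ?_⟩
    simp only [sliceVector, coord_add, add_smul, Finset.sum_add_distrib]
    abel
  smul_mem' := by
    rintro c _ ⟨a, y, z, d, rfl⟩
    refine ⟨c • a, c • y, c • z, c • d, ?_⟩
    simp only [sliceVector, coord_smul, mul_smul, ← Finset.smul_sum, smul_add, smul_sub]

lemma sliceDirection_le_soD (m n : ℕ) : sliceDirection m n ≤ soD (Idx m n) := by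
  have h (s : Finset ℕ) (c : ℕ → ℂ) (x y : ℕ → Idx m n ⊕ Idx m n → ℂ) :
      ∑ k ∈ s, c k • wedge (x k) (y k) ∈ soD (Idx m n) :=
    Submodule.sum_mem _ fun k _ => Submodule.smul_mem _ _ (wedge_mem_soD _ _)
  rintro _ ⟨a, y, z, d, rfl⟩
  exact Submodule.sub_mem _ (Submodule.add_mem _ (Submodule.add_mem _ (h _ _ _ _) (h _ _ _ _))
    (h _ _ _ _)) (h _ _ _ _)

lemma wedge_vecU_vecU_mem {k : ℕ} (hk : k < m - n - 1) :
    wedge (vecU m n k) (vecU m n (k + 1)) ∈ sliceDirection m n := by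
  refine ⟨0, 0, 0, Pi.single ⟨m - n - 1 - k - 1, by omega⟩ 1, ?_⟩
  simp only [sliceVector, coord_zero, zero_smul, Finset.sum_const_zero, add_zero, sub_zero]
  rw [Finset.sum_eq_single k]
  · rw [coord_single, if_pos (by simp only; omega), one_smul]
  · intro j hj hjk
    rw [Finset.mem_range] at hj
    rw [coord_single, if_neg (by simp only; omega), zero_smul]
  · intro h
    exact absurd (Finset.mem_range.2 hk) h

lemma wedge_vecW_vecW_mem {k : ℕ} (hk : k < n) :
    wedge (vecW m n k) (vecW m n (k + 1)) ∈ sliceDirection m n := by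
  refine ⟨Pi.single ⟨n - k - 1, by omega⟩ 1, 0, 0, 0, ?_⟩
  simp only [sliceVector, coord_zero, zero_smul, Finset.sum_const_zero, add_zero, zero_add,
    sub_zero]
  rw [Finset.sum_eq_single k]
  · rw [coord_single, if_pos (by simp only; omega), one_smul]
  · intro j hj hjk
    rw [Finset.mem_range] at hj
    rw [coord_single, if_neg (by simp only; omega), zero_smul]
  · intro h
    exact absurd (Finset.mem_range.2 hk) h

lemma wedge_vecU_vecW_mem {k : ℕ} (hk : k < n) :
    wedge (vecU m n 0) (vecW m n k) ∈ sliceDirection m n := by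
  refine ⟨0, Pi.single ⟨k, hk⟩ 1, 0, 0, ?_⟩
  simp only [sliceVector, coord_zero, zero_smul, Finset.sum_const_zero, zero_add, sub_zero]
  rw [Finset.sum_eq_single k]
  · rw [coord_single, if_pos rfl, one_smul]
  · intro j _ hjk
    rw [coord_single, if_neg (by simp only; omega), zero_smul]
  · intro h
    exact absurd (Finset.mem_range.2 hk) h

lemma wedge_vecU_vecW_last_mem {k : ℕ} (hk : k ≤ n) :
    wedge (vecU m n k) (vecW m n n) ∈ sliceDirection m n := by
  rw [← neg_mem_iff]
  refine ⟨0, 0, Pi.single ⟨k, by omega⟩ 1, 0, ?_⟩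
  simp only [sliceVector, coord_zero, zero_smul, Finset.sum_const_zero, zero_add, zero_sub]
  rw [Finset.sum_eq_single k]
  · rw [coord_single, if_pos rfl, one_smul]
  · intro j _ hjk
    rw [coord_single, if_neg (by simp only; omega), zero_smul]
  · intro h
    exact absurd (Finset.mem_range.2 (by omega)) h

end Direction

/-! ### The orbit and the slice span `so` -/

section Centralizer

variable {m n q : ℕ}

/-- No nonzero element of the centralizer of `X_n` is orthogonal to the direction of the slice.
Such an element `c` is determined by the moments `(u, c T^k u)`, `(u, c T^k w)` and
`(w, c T^k w)`, where `u = u_0` and `w = w_0`. By skewness these either vanish or are, up to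
sign, the pairings of `c` with the wedges which span the direction of the slice. -/
lemma eq_zero_of_commute_of_trace_eq_zero (hp : m - n = q + 1) (hn : n ≤ q) {c : Mat (Idx m n)}
    (hc : c ∈ soD (Idx m n)) (hcomm : Commute c (nilp m n))
    (htr : ∀ s ∈ sliceDirection m n, (c * s).trace = 0) : c = 0 := by
  have hcT (k : ℕ) (v : Idx m n ⊕ Idx m n → ℂ) :
      c.mulVec ((shift m n k).mulVec v) = (shift m n k).mulVec (c.mulVec v) := by
    rw [Matrix.mulVec_mulVec, Matrix.mulVec_mulVec, shift, (hcomm.neg_right.pow_right k).eq]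
  have hwedge {x y : Idx m n ⊕ Idx m n → ℂ} (h : wedge x y ∈ sliceDirection m n) :
      form _ x (c.mulVec y) = 0 := by
    have := htr _ h
    rw [trace_mul_wedge hc] at this
    simpa using this
  have hsplit (i j : ℕ) (x y : Idx m n ⊕ Idx m n → ℂ) :
      form _ x (c.mulVec ((shift m n (i + j)).mulVec y)) =
        (-1) ^ i * form _ ((shift m n i).mulVec x) (c.mulVec ((shift m n j).mulVec y)) := by
    rw [hcT, hcT, form_shift_add]
  have heven (i : ℕ) (x : Idx m n ⊕ Idx m n → ℂ) :
      form _ x (c.mulVec ((shift m n (2 * i)).mulVec x)) = 0 := by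
    rw [two_mul, hsplit, form_mulVec_self hc, mul_zero]
  have hUU (k : ℕ) : form _ (vecU m n 0) (c.mulVec ((shift m n k).mulVec (vecU m n 0))) = 0 := by
    rcases le_or_gt k (2 * q) with hk | hk
    · obtain ⟨i, rfl | rfl⟩ := Nat.even_or_odd' k
      · exact heven i _
      · rw [show 2 * i + 1 = i + (i + 1) by ring, hsplit, shift_mulVec_vecU hp (by omega),
          shift_mulVec_vecU hp (by omega), hwedge (wedge_vecU_vecU_mem (by omega)), mul_zero]
    · rw [shift_mulVec_vecU_eq_zero hp hn (by omega), Matrix.mulVec_zero, map_zero]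
  have hUW (k : ℕ) : form _ (vecU m n 0) (c.mulVec ((shift m n k).mulVec (vecW m n 0))) = 0 := by
    rcases lt_or_ge k n with hk | hk
    · rw [shift_mulVec_vecW hk.le, hwedge (wedge_vecU_vecW_mem hk)]
    rcases le_or_gt k (2 * n) with hk' | hk'
    · obtain ⟨i, rfl⟩ := Nat.exists_eq_add_of_le' hk
      rw [hsplit, shift_mulVec_vecU hp (by omega), shift_mulVec_vecW le_rfl,
        hwedge (wedge_vecU_vecW_last_mem (by omega)), mul_zero]
    · rw [shift_mulVec_vecW_eq hp hn hk', Matrix.mulVec_smul, map_smul, hUU, smul_zero]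
  have hWU (k : ℕ) : form _ (vecW m n 0) (c.mulVec ((shift m n k).mulVec (vecU m n 0))) = 0 := by
    have h := form_mulVec_of_mem_soD hc (vecW m n 0) ((shift m n k).mulVec (vecU m n 0))
    rw [form_comm, form_shift, ← hcT, hUW, mul_zero, eq_comm, neg_eq_zero] at h
    exact h
  have hWW (k : ℕ) : form _ (vecW m n 0) (c.mulVec ((shift m n k).mulVec (vecW m n 0))) = 0 := by
    rcases le_or_gt k (2 * n) with hk | hk
    · obtain ⟨i, rfl | rfl⟩ := Nat.even_or_odd' k
      · exact heven i _
      · rw [show 2 * i + 1 = i + (i + 1) by ring, hsplit, shift_mulVec_vecW (by omega),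
          shift_mulVec_vecW (by omega), hwedge (wedge_vecW_vecW_mem (by omega)), mul_zero]
    · rw [shift_mulVec_vecW_eq hp hn hk, Matrix.mulVec_smul, map_smul, hWU, smul_zero]
  -- The vectors `y` all of whose shifts have image under `c` orthogonal to `x`.
  have hzero (x : Idx m n ⊕ Idx m n → ℂ)
      (hU : ∀ k, form _ x (c.mulVec ((shift m n k).mulVec (vecU m n 0))) = 0)
      (hW : ∀ k, form _ x (c.mulVec ((shift m n k).mulVec (vecW m n 0))) = 0) :
      c.mulVec x = 0 := by
    let N : Submodule ℂ (Idx m n ⊕ Idx m n → ℂ) :=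
      { carrier := {y | ∀ k, form _ x (c.mulVec ((shift m n k).mulVec y)) = 0}
        zero_mem' := fun k => by simp
        add_mem' := fun {y z} hy hz k => by
          rw [Matrix.mulVec_add, Matrix.mulVec_add, map_add, hy k, hz k, add_zero]
        smul_mem' := fun r y hy k => by
          rw [Matrix.mulVec_smul, Matrix.mulVec_smul, map_smul, hy k, smul_zero] }
    have hN : N = ⊤ := by
      refine eq_top_of_nilp_invariant hp (fun v hv k => ?_) hU hW
      have h := hv (k + 1)
      rw [← shift_mulVec_shift, shift_succ_mulVec 0, shift_zero_mulVec, Matrix.mulVec_neg,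
        Matrix.mulVec_neg, map_neg, neg_eq_zero] at h
      exact h
    refine eq_zero_of_form_eq_zero fun y => ?_
    have hy : y ∈ N := hN ▸ Submodule.mem_top
    have h := hy 0
    rw [shift_zero_mulVec] at h
    rw [form_comm, form_mulVec_of_mem_soD hc, h, neg_zero]
  have hker : LinearMap.ker c.mulVecLin = ⊤ := by
    refine eq_top_of_nilp_invariant hp (fun v hv => ?_) (hzero _ hUU hUW) (hzero _ hWU hWW)
    rw [LinearMap.mem_ker, Matrix.mulVecLin_apply] at *
    rw [Matrix.mulVec_mulVec, hcomm.eq, ← Matrix.mulVec_mulVec, hv, Matrix.mulVec_zero]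
  rw [LinearMap.ker_eq_top] at hker
  ext i j
  have h := congrFun (LinearMap.congr_fun hker (Pi.single j 1)) i
  simpa using h

end Centralizer

/-! ### The orbit and the slice meet transversally -/

section Intersection

variable {m n q : ℕ}

/-- The functional `s ↦ ∑_{i + j = K} (-1)^i (T^i x, s T^j y)`. -/
def alternatingPairing (K : ℕ) (x y : Idx m n ⊕ Idx m n → ℂ) : Mat (Idx m n) →ₗ[ℂ] ℂ where
  toFun s := ∑ i ∈ Finset.range (K + 1),
    (-1) ^ i * form _ ((shift m n i).mulVec x) (s.mulVec ((shift m n (K - i)).mulVec y))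
  map_add' s s' := by simp only [Matrix.add_mulVec, map_add, mul_add, Finset.sum_add_distrib]
  map_smul' r s := by simp [Matrix.smul_mulVec, Finset.mul_sum, mul_left_comm]

lemma alternatingPairing_apply (K : ℕ) (x y : Idx m n ⊕ Idx m n → ℂ) (s : Mat (Idx m n)) :
    alternatingPairing K x y s = ∑ i ∈ Finset.range (K + 1),
      (-1) ^ i * form _ ((shift m n i).mulVec x) (s.mulVec ((shift m n (K - i)).mulVec y)) := rfl

/-- On the commutators `[Z, X_n]` the sum defining the functional telescopes. -/
lemma alternatingPairing_commutator {K : ℕ} {x y : Idx m n ⊕ Idx m n → ℂ}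
    (hx : (shift m n (K + 1)).mulVec x = 0) (hy : (shift m n (K + 1)).mulVec y = 0)
    (Z : Mat (Idx m n)) : alternatingPairing K x y (Z * nilp m n - nilp m n * Z) = 0 := by
  set f : ℕ → ℂ := fun i => (-1) ^ i *
    form _ ((shift m n i).mulVec x) (Z.mulVec ((shift m n (K + 1 - i)).mulVec y)) with hf
  have h : ∀ i ∈ Finset.range (K + 1), (-1) ^ i * form _ ((shift m n i).mulVec x)
      ((Z * nilp m n - nilp m n * Z).mulVec ((shift m n (K - i)).mulVec y)) = f (i + 1) - f i := by
    intro i hi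
    rw [Finset.mem_range] at hi
    simp only [hf]
    rw [show K + 1 - (i + 1) = K - i by omega, show K + 1 - i = K - i + 1 by omega,
      shift_succ_mulVec, shift_succ_mulVec, Matrix.mulVec_neg, map_neg, map_neg,
      LinearMap.neg_apply, form_mulVec_of_mem_soD (nilp_mem_soD m n), Matrix.sub_mulVec, map_sub,
      ← Matrix.mulVec_mulVec, ← Matrix.mulVec_mulVec]
    ring
  rw [alternatingPairing_apply, Finset.sum_congr rfl h, Finset.sum_range_sub]
  simp only [hf, hx, Nat.sub_zero, hy, Matrix.mulVec_zero, map_zero, LinearMap.zero_apply, mul_zero,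
    sub_zero]

lemma alternatingPairing_wedge (K : ℕ) (x y v v' : Idx m n ⊕ Idx m n → ℂ) :
    alternatingPairing K x y (wedge v v') =
      ∑ i ∈ Finset.range (K + 1), (-1) ^ i * (form _ ((shift m n i).mulVec x) v *
        form _ ((shift m n (K - i)).mulVec y) v') -
      ∑ i ∈ Finset.range (K + 1), (-1) ^ i * (form _ ((shift m n i).mulVec x) v' *
        form _ ((shift m n (K - i)).mulVec y) v) := by
  rw [alternatingPairing_apply, ← Finset.sum_sub_distrib]
  refine Finset.sum_congr rfl fun i _ => ?_
  rw [wedge_mulVec, map_sub, map_smul, map_smul, form_comm v', form_comm v, smul_eq_mul,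
    smul_eq_mul]
  ring

/-- The alternating convolution of two sequences, each concentrated in one degree. -/
lemma sum_alternating_ite {N N' k k' : ℕ} (hk : k ≤ N) (hk' : k' ≤ N') (K : ℕ) (b b' : ℂ) :
    ∑ i ∈ Finset.range (K + 1), (-1) ^ i * ((if i + k = N then b * (-1) ^ i else 0) *
      (if K - i + k' = N' then b' * (-1) ^ (K - i) else 0)) =
    if K + k + k' = N + N' then b * b' * (-1) ^ (N' - k') else 0 := by
  split_ifs with h
  · rw [Finset.sum_eq_single (N - k)]
    · rw [if_pos (by omega), if_pos (by omega), show K - (N - k) = N' - k' by omega]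
      have : (-1 : ℂ) ^ (N - k) * (-1) ^ (N - k) = 1 := by rw [← mul_pow]; simp
      linear_combination b * b' * (-1) ^ (N' - k') * this
    · intro i _ hi
      rw [if_neg (by omega), zero_mul, mul_zero]
    · intro h'
      rw [Finset.mem_range] at h'
      omega
  · refine Finset.sum_eq_zero fun i hi => ?_
    rw [Finset.mem_range] at hi
    by_cases h1 : i + k = N
    · rw [if_neg (show ¬ K - i + k' = N' by omega), mul_zero, mul_zero]
    · rw [if_neg h1, zero_mul, mul_zero]

lemma form_shift_vecU_vecU (hp : m - n = q + 1) (hn : n ≤ q) (i : ℕ) {k : ℕ} (hk : k ≤ q) :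
    form _ ((shift m n i).mulVec (vecU m n 0)) (vecU m n k) =
      if i + k = 2 * q then 2 * (-1) ^ q * (-1) ^ i else 0 := by
  rw [form_shift, ← shift_mulVec_vecU hp hk, shift_mulVec_shift, form_vecU_shift_vecU hp hn]
  split_ifs <;> ring

lemma form_shift_vecW'_vecU (hp : m - n = q + 1) (hn : n ≤ q) (i : ℕ) {k : ℕ} (hk : k ≤ q) :
    form _ ((shift m n i).mulVec (vecW' m n)) (vecU m n k) = 0 := by
  rw [form_shift, ← shift_mulVec_vecU hp hk, shift_mulVec_shift, form_vecW'_shift_vecU hp hn,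
    mul_zero]

lemma form_shift_vecW'_vecW (hp : m - n = q + 1) (hn : n ≤ q) (i : ℕ) {k : ℕ} (hk : k ≤ n) :
    form _ ((shift m n i).mulVec (vecW' m n)) (vecW m n k) =
      if i + k = 2 * n then -(-1) ^ n / 2 * (-1) ^ i else 0 := by
  rw [form_shift, ← shift_mulVec_vecW hk, shift_mulVec_shift, form_vecW'_shift_vecW hp hn]
  split_ifs <;> ring

lemma alternatingPairing_vecW_vecW (hp : m - n = q + 1) (hn : n ≤ q) (K : ℕ) {k : ℕ} (hk : k < n) :
    alternatingPairing K (vecW' m n) (vecW' m n) (wedge (vecW m n k) (vecW m n (k + 1))) =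
      if K + 2 * k + 1 = 4 * n then -(-1) ^ k / 2 else 0 := by
  rw [alternatingPairing_wedge]
  simp only [form_shift_vecW'_vecW hp hn _ hk.le, form_shift_vecW'_vecW hp hn _ hk]
  rw [sum_alternating_ite (by omega) (by omega), sum_alternating_ite (by omega) (by omega)]
  by_cases h : K + 2 * k + 1 = 4 * n
  · rw [if_pos (by omega), if_pos (by omega), if_pos h]
    obtain ⟨r, rfl⟩ : ∃ r, n = k + 1 + r := ⟨n - k - 1, by omega⟩
    rw [show 2 * (k + 1 + r) - (k + 1) = k + 1 + 2 * r by omega,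
      show 2 * (k + 1 + r) - k = k + 2 * (1 + r) by omega, pow_add (-1 : ℂ) (k + 1) (2 * r),
      pow_add (-1 : ℂ) k (2 * (1 + r)), pow_mul, pow_mul, neg_one_sq, one_pow, one_pow]
    have : (-1 : ℂ) ^ (k + 1 + r) * (-1) ^ (k + 1 + r) = 1 := by rw [← mul_pow]; simp
    linear_combination (-1 / 2) * (-1) ^ k * this
  · rw [if_neg (by omega), if_neg (by omega), if_neg h, sub_zero]

lemma alternatingPairing_vecU_vecU (hp : m - n = q + 1) (hn : n ≤ q) (K : ℕ) {k : ℕ} (hk : k < q) :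
    alternatingPairing K (vecU m n 0) (vecU m n 0) (wedge (vecU m n k) (vecU m n (k + 1))) =
      if K + 2 * k + 1 = 4 * q then -8 * (-1) ^ k else 0 := by
  rw [alternatingPairing_wedge]
  simp only [form_shift_vecU_vecU hp hn _ hk.le, form_shift_vecU_vecU hp hn _ hk]
  rw [sum_alternating_ite (by omega) (by omega), sum_alternating_ite (by omega) (by omega)]
  by_cases h : K + 2 * k + 1 = 4 * q
  · rw [if_pos (by omega), if_pos (by omega), if_pos h]
    obtain ⟨r, rfl⟩ : ∃ r, q = k + 1 + r := ⟨q - k - 1, by omega⟩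
    rw [show 2 * (k + 1 + r) - (k + 1) = k + 1 + 2 * r by omega,
      show 2 * (k + 1 + r) - k = k + 2 * (1 + r) by omega, pow_add (-1 : ℂ) (k + 1) (2 * r),
      pow_add (-1 : ℂ) k (2 * (1 + r)), pow_mul, pow_mul, neg_one_sq, one_pow, one_pow]
    have : (-1 : ℂ) ^ (k + 1 + r) * (-1) ^ (k + 1 + r) = 1 := by rw [← mul_pow]; simp
    linear_combination (-8) * (-1) ^ k * this
  · rw [if_neg (by omega), if_neg (by omega), if_neg h, sub_zero]

lemma alternatingPairing_vecU_vecW (hp : m - n = q + 1) (hn : n ≤ q) (K : ℕ) {j k : ℕ}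
    (hj : j ≤ q) (hk : k ≤ n) :
    alternatingPairing K (vecW' m n) (vecU m n 0) (wedge (vecU m n j) (vecW m n k)) =
      if K + j + k = 2 * n + 2 * q then (-1) ^ (n + q + j) else 0 := by
  rw [alternatingPairing_wedge]
  simp only [form_shift_vecW'_vecU hp hn _ hj, zero_mul, mul_zero, Finset.sum_const_zero,
    form_shift_vecW'_vecW hp hn _ hk, form_shift_vecU_vecU hp hn _ hj]
  rw [sum_alternating_ite (by omega) (by omega)]
  by_cases h : K + j + k = 2 * n + 2 * q
  · rw [if_pos (by omega), if_pos h]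
    obtain ⟨r, rfl⟩ : ∃ r, q = j + r := ⟨q - j, by omega⟩
    rw [show 2 * (j + r) - j = j + 2 * r by omega, pow_add (-1 : ℂ) j (2 * r), pow_mul, neg_one_sq,
      one_pow]
    ring
  · rw [if_neg (by omega), if_neg h, sub_zero]

lemma alternatingPairing_vecW'_vecU_of_vecU (hp : m - n = q + 1) (hn : n ≤ q) (K : ℕ) {j k : ℕ}
    (hj : j ≤ q) (hk : k ≤ q) (y : Idx m n ⊕ Idx m n → ℂ) :
    alternatingPairing K (vecW' m n) y (wedge (vecU m n j) (vecU m n k)) = 0 := by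
  rw [alternatingPairing_wedge]
  simp [form_shift_vecW'_vecU hp hn _ hj, form_shift_vecW'_vecU hp hn _ hk]

lemma alternatingPairing_vecW'_self_of_vecU (hp : m - n = q + 1) (hn : n ≤ q) (K : ℕ) {j : ℕ}
    (hj : j ≤ q) (y : Idx m n ⊕ Idx m n → ℂ) :
    alternatingPairing K (vecW' m n) (vecW' m n) (wedge (vecU m n j) y) = 0 := by
  rw [alternatingPairing_wedge]
  simp [form_shift_vecW'_vecU hp hn _ hj]

lemma sliceVector_eq (hp : m - n = q + 1) (a y : Fin n → ℂ) (z : Fin (n + 1) → ℂ)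
    (d : Fin (m - n - 1) → ℂ) : sliceVector m n a y z d =
      ∑ k ∈ Finset.range q, coord d (q - k) • wedge (vecU m n k) (vecU m n (k + 1)) +
      ∑ k ∈ Finset.range n, coord a (n - k) • wedge (vecW m n k) (vecW m n (k + 1)) +
      ∑ k ∈ Finset.range n, coord y (k + 1) • wedge (vecU m n 0) (vecW m n k) -
      ∑ k ∈ Finset.range (n + 1), coord z (k + 1) • wedge (vecU m n k) (vecW m n n) := by
  rw [sliceVector, Finset.sum_congr (g := fun k => coord d (q - k) •
    wedge (vecU m n k) (vecU m n (k + 1))) (congrArg Finset.range (show m - n - 1 = q by omega))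
    fun k _ => by rw [show m - n - 1 - k = q - k by omega]]

/-- The functionals given by the generators `w` and `u` recover all coordinates of an element of
the direction of the slice from its alternating pairings: `(w, w)` gives the `a_i`, then `(w, u)`
the `y_i` and `z_j`, and then `(u, u)` the `d_k`. -/
lemma sliceVector_eq_zero (hp : m - n = q + 1) (hn : n ≤ q) {a y : Fin n → ℂ}
    {z : Fin (n + 1) → ℂ} {d : Fin (m - n - 1) → ℂ}
    (hww : ∀ K, 2 * n ≤ K →
      alternatingPairing K (vecW' m n) (vecW' m n) (sliceVector m n a y z d) = 0)
    (hwu : ∀ K, 2 * q ≤ K →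
      alternatingPairing K (vecW' m n) (vecU m n 0) (sliceVector m n a y z d) = 0)
    (huu : ∀ K, 2 * q ≤ K →
      alternatingPairing K (vecU m n 0) (vecU m n 0) (sliceVector m n a y z d) = 0) :
    sliceVector m n a y z d = 0 := by
  -- In each step the degree `K` is the one in which, among the remaining wedges, only the one
  -- carrying the coordinate in question has a nonzero pairing.
  have hpow (k : ℕ) : (-1 : ℂ) ^ k ≠ 0 := pow_ne_zero _ (by norm_num)
  have ha : ∀ k ∈ Finset.range n, coord a (n - k) = 0 := by
    intro k hk
    have hk' := Finset.mem_range.1 hk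
    have h := hww (4 * n - 2 * k - 1) (by omega)
    simp only [sliceVector, map_add, map_sub, map_sum, map_smul, smul_eq_mul] at h
    rw [Finset.sum_eq_zero, Finset.sum_eq_single_of_mem k hk, Finset.sum_eq_zero,
      Finset.sum_eq_zero, alternatingPairing_vecW_vecW hp hn _ hk', if_pos (by omega)] at h
    · simpa [hpow] using h
    · intro j hj
      rw [Finset.mem_range] at hj
      rw [alternatingPairing_vecW'_self_of_vecU hp hn _ (by omega), mul_zero]
    · intro j _
      rw [alternatingPairing_vecW'_self_of_vecU hp hn _ (by omega), mul_zero]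
    · intro j hj hjk
      rw [alternatingPairing_vecW_vecW hp hn _ (Finset.mem_range.1 hj), if_neg (by omega), mul_zero]
    · intro j hj
      rw [Finset.mem_range] at hj
      rw [alternatingPairing_vecW'_self_of_vecU hp hn _ (by omega), mul_zero]
  have hs : sliceVector m n a y z d =
      ∑ k ∈ Finset.range q, coord d (q - k) • wedge (vecU m n k) (vecU m n (k + 1)) +
      ∑ k ∈ Finset.range n, coord y (k + 1) • wedge (vecU m n 0) (vecW m n k) -
      ∑ k ∈ Finset.range (n + 1), coord z (k + 1) • wedge (vecU m n k) (vecW m n n) := by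
    rw [sliceVector_eq hp, Finset.sum_eq_zero (s := Finset.range n) (f := fun k => coord a (n - k) •
      wedge (vecW m n k) (vecW m n (k + 1))) fun k hk => by rw [ha k hk, zero_smul], add_zero]
  have hd0 (K : ℕ) : ∑ k ∈ Finset.range q, coord d (q - k) * alternatingPairing K (vecW' m n)
      (vecU m n 0) (wedge (vecU m n k) (vecU m n (k + 1))) = 0 := by
    refine Finset.sum_eq_zero fun k hk => ?_
    rw [Finset.mem_range] at hk
    rw [alternatingPairing_vecW'_vecU_of_vecU hp hn _ (by omega) (by omega), mul_zero]
  have hy : ∀ k ∈ Finset.range n, coord y (k + 1) = 0 := by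
    intro k hk
    have hk' := Finset.mem_range.1 hk
    have h := hwu (2 * n + 2 * q - k) (by omega)
    simp only [hs, map_add, map_sub, map_sum, map_smul, smul_eq_mul] at h
    rw [hd0, Finset.sum_eq_single_of_mem k hk, Finset.sum_eq_zero,
      alternatingPairing_vecU_vecW hp hn _ (by omega) hk'.le, if_pos (by omega)] at h
    · simpa [hpow] using h
    · intro j hj
      rw [Finset.mem_range] at hj
      rw [alternatingPairing_vecU_vecW hp hn _ (by omega) le_rfl, if_neg (by omega), mul_zero]
    · intro j hj hjk
      rw [alternatingPairing_vecU_vecW hp hn _ (by omega) (Finset.mem_range.1 hj).le,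
        if_neg (by omega), mul_zero]
  have hz : ∀ k ∈ Finset.range (n + 1), coord z (k + 1) = 0 := by
    intro k hk
    have hk' := Finset.mem_range.1 hk
    have h := hwu (n + 2 * q - k) (by omega)
    simp only [hs, map_add, map_sub, map_sum, map_smul, smul_eq_mul] at h
    rw [hd0, Finset.sum_eq_zero, Finset.sum_eq_single_of_mem k hk,
      alternatingPairing_vecU_vecW hp hn _ (by omega) le_rfl, if_pos (by omega)] at h
    · simpa [hpow] using h
    · intro j hj hjk
      rw [Finset.mem_range] at hj
      rw [alternatingPairing_vecU_vecW hp hn _ (by omega) le_rfl, if_neg (by omega), mul_zero]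
    · intro j hj
      rw [hy j hj, zero_mul]
  have hs' : sliceVector m n a y z d =
      ∑ k ∈ Finset.range q, coord d (q - k) • wedge (vecU m n k) (vecU m n (k + 1)) := by
    rw [hs, Finset.sum_eq_zero (s := Finset.range n) fun k hk => by rw [hy k hk, zero_smul],
      Finset.sum_eq_zero (s := Finset.range (n + 1)) fun k hk => by rw [hz k hk, zero_smul],
      add_zero, sub_zero]
  have hd : ∀ k ∈ Finset.range q, coord d (q - k) = 0 := by
    intro k hk
    have hk' := Finset.mem_range.1 hk
    have h := huu (4 * q - 2 * k - 1) (by omega)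
    simp only [hs', map_sum, map_smul, smul_eq_mul] at h
    rw [Finset.sum_eq_single_of_mem k hk, alternatingPairing_vecU_vecU hp hn _ hk',
      if_pos (by omega)] at h
    · simpa [hpow] using h
    · intro j hj hjk
      rw [alternatingPairing_vecU_vecU hp hn _ (Finset.mem_range.1 hj), if_neg (by omega), mul_zero]
  rw [hs']
  exact Finset.sum_eq_zero fun k hk => by rw [hd k hk, zero_smul]

lemma orbitTangentSpace_inf_sliceDirection (hp : m - n = q + 1) (hn : n ≤ q) :
    orbitTangentSpace (nilp m n) ⊓ sliceDirection m n = ⊥ := by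
  refine eq_bot_iff.2 fun s hs => ?_
  obtain ⟨hs1, a, y, z, d, rfl⟩ := Submodule.mem_inf.1 hs
  obtain ⟨Z, -, hZ⟩ := mem_orbitTangentSpace_iff.1 hs1
  rw [Submodule.mem_bot]
  refine sliceVector_eq_zero hp hn (fun K hK => ?_) (fun K hK => ?_) fun K hK => ?_
  all_goals
    rw [hZ]
    refine alternatingPairing_commutator ?_ ?_ Z
    all_goals first
      | exact shift_mulVec_vecW'_eq_zero hp hn (by omega)
      | exact shift_mulVec_vecU_eq_zero hp hn (by omega)

lemma coe_mk'_sliceDirection (hp : m - n = q + 1) (hn : n ≤ q) :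
    (AffineSubspace.mk' (nilp m n) (sliceDirection m n) : Set (Mat (Idx m n))) = slice m n := by
  ext Y
  rw [SetLike.mem_coe, AffineSubspace.mem_mk', vsub_eq_sub]
  constructor
  · rintro ⟨a, y, z, d, h⟩
    refine ⟨a, y, z, d, ?_⟩
    rw [slicePoint_eq_add_sliceVector (by omega), ← h, add_sub_cancel]
  · rintro ⟨a, y, z, d, rfl⟩
    refine ⟨a, y, z, d, ?_⟩
    rw [slicePoint_eq_add_sliceVector (by omega), add_sub_cancel_left]

lemma isTransverseSlice_mk'_sliceDirection (hp : m - n = q + 1) (hn : n ≤ q) :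
    IsTransverseSlice (nilp m n) (AffineSubspace.mk' (nilp m n) (sliceDirection m n)) where
  subset_so Y hY := by
    rw [SetLike.mem_coe, AffineSubspace.mem_mk', vsub_eq_sub] at hY
    simpa using Submodule.add_mem _ (sliceDirection_le_soD m n hY) (nilp_mem_soD m n)
  mem := AffineSubspace.self_mem_mk' _ _
  inf_eq_bot := by
    rw [AffineSubspace.direction_mk', orbitTangentSpace_inf_sliceDirection hp hn]
  sup_eq_so := by
    rw [AffineSubspace.direction_mk']
    exact orbitTangentSpace_sup_eq_soD (nilp_mem_soD m n) (sliceDirection_le_soD m n)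
      fun c hc hcomm h => eq_zero_of_commute_of_trace_eq_zero hp hn hc hcomm h

end Intersection

/-! ### Block determinants -/

section Determinants

lemma det_JD (l : Type) [Fintype l] [DecidableEq l] :
    (LieAlgebra.Orthogonal.JD l ℂ).det = (-1) ^ Fintype.card l := by
  have h : LieAlgebra.Orthogonal.JD l ℂ * Matrix.fromBlocks 1 0 1 1 =
      Matrix.fromBlocks 1 1 1 0 := by
    simp [LieAlgebra.Orthogonal.JD, Matrix.fromBlocks_multiply]
  have h' := congrArg Matrix.det h
  rw [Matrix.det_mul, Matrix.det_fromBlocks_zero₁₂, Matrix.det_fromBlocks_one₁₁] at h'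
  simpa [Matrix.det_neg] using h'

/-- The determinant of the block matrix `[[A, B, 0], [C, D, T'], [0, T, 0]]`. -/
lemma det_fromBlocks_corner {κ μ : Type} [Fintype κ] [DecidableEq κ] [Fintype μ] [DecidableEq μ]
    (A : Matrix μ μ ℂ) (B : Matrix μ κ ℂ) (C : Matrix κ μ ℂ) (D T' T : Matrix κ κ ℂ)
    (hT : IsUnit T.det) :
    (Matrix.fromBlocks A (Matrix.fromCols B 0) (Matrix.fromRows C 0)
      (Matrix.fromBlocks D T' T 0)).det = A.det * ((-1) ^ Fintype.card κ * T.det * T'.det) := by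
  -- The block `B` is cleared by the rows through the invertible block `T`.
  have h1 : Matrix.fromBlocks A (Matrix.fromCols B 0) (Matrix.fromRows C 0)
      (Matrix.fromBlocks D T' T 0) = Matrix.fromBlocks 1 (Matrix.fromCols 0 (B * T⁻¹)) 0 1 *
        Matrix.fromBlocks A 0 (Matrix.fromRows C 0) (Matrix.fromBlocks D T' T 0) := by
    rw [Matrix.fromBlocks_multiply]
    simp [Matrix.fromCols_mul_fromRows, Matrix.fromCols_mul_fromBlocks, Matrix.mul_assoc,
      Matrix.nonsing_inv_mul _ hT]
  have h2 : Matrix.fromBlocks D T' T 0 =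
      LieAlgebra.Orthogonal.JD κ ℂ * Matrix.fromBlocks T 0 D T' := by
    simp [LieAlgebra.Orthogonal.JD, Matrix.fromBlocks_multiply]
  rw [h1, Matrix.det_mul, Matrix.det_fromBlocks_zero₂₁, Matrix.det_fromBlocks_zero₁₂, h2,
    Matrix.det_mul, det_JD, Matrix.det_fromBlocks_zero₁₂]
  simp [mul_assoc]

end Determinants

/-! ### Pairings of the generating vectors -/

section Gram

variable {m n q : ℕ}

/-- The vectors `β_k`, counted from `1`: `β_k = f_k` for `k ≤ n` and `β_{n+1} = e_p - e*_p` with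
`p = m - n`, so that `X_n β_k = β_{k-1}`. -/
def vecB (m n k : ℕ) : Idx m n ⊕ Idx m n → ℂ :=
  vecF m n k +
    if k = n + 1 then (2 : ℂ) • vecE m n (m - n) - vecU m n (m - n - 1) else 0

lemma vecB_zero (m n : ℕ) : vecB m n 0 = 0 := by
  simp [vecB, vecF_zero]

lemma vecB_last (hp : m - n = q + 1) :
    vecB m n (n + 1) = (2 : ℂ) • vecE m n (q + 1) - vecU m n q := by
  have h : vecF m n (n + 1) = 0 := by
    ext ((i | i) | (i | i)) <;> simp [vecF, i.2.ne]
  rw [vecB, h, if_pos rfl, zero_add, show m - n - 1 = q by omega,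
    congrArg (vecE m n) hp]

lemma vecB_of_le {k : ℕ} (h : k ≤ n) : vecB m n k = vecF m n k := by
  rw [vecB, if_neg (by omega), add_zero]

lemma nilp_mulVec_vecB (hp : m - n = q + 1) {k : ℕ} (h : k ≤ n + 1) :
    (nilp m n).mulVec (vecB m n k) = vecB m n (k - 1) := by
  rcases h.lt_or_eq with h | rfl
  · rw [vecB_of_le (by omega), vecB_of_le (by omega), nilp_mulVec_vecF (by omega)]
  · rw [vecB_last hp, Nat.add_sub_cancel, vecB_of_le le_rfl, Matrix.mulVec_sub, Matrix.mulVec_smul,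
      nilp_mulVec_vecE (by omega), nilp_mulVec_vecU_last hp, Nat.add_sub_cancel, sub_sub_cancel]

lemma form_vecU_vecE (hp : m - n = q + 1) {k i : ℕ} (hk : k ≤ q) :
    form _ (vecU m n k) (vecE m n (i + 1)) = if k = i then 1 else 0 := by
  rw [form_vecU (by omega)]
  simp [vecE]

lemma form_vecU_vecB (hp : m - n = q + 1) {k i : ℕ} (hk : k ≤ q) (hi : i ≤ n) :
    form _ (vecU m n k) (vecB m n (i + 1)) = 0 := by
  rcases hi.lt_or_eq with h | rfl
  · rw [vecB_of_le (by omega), form_vecU (by omega)]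
    simp [vecF]
  · rw [vecB_last hp, map_sub, map_smul, form_vecU_vecE hp hk, form_vecU_vecU hp hk]
    split_ifs <;> simp_all

lemma form_vecW_vecE (hp : m - n = q + 1) {k i : ℕ} (hk : k ≤ n) :
    form _ (vecW m n k) (vecE m n i) = 0 := by
  rcases hk.lt_or_eq with h | rfl
  · rw [form_vecW_of_lt h]
    simp [vecE]
  · rw [form_vecW_last hp]
    simp [vecE]

lemma form_vecW_vecB (hp : m - n = q + 1) {k i : ℕ} (hk : k ≤ n) (hi : i ≤ n) :
    form _ (vecW m n k) (vecB m n (i + 1)) = if k = i then 1 else 0 := by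
  rcases hi.lt_or_eq with h | rfl
  · rw [vecB_of_le (by omega)]
    rcases hk.lt_or_eq with h' | rfl
    · rw [form_vecW_of_lt h']
      simp [vecF]
    · rw [form_vecW_last hp, if_neg (by omega)]
      simp [vecF]
  · rw [vecB_last hp, map_sub, map_smul, form_vecW_vecE hp hk, form_comm,
      form_vecU_vecW hp le_rfl]
    split_ifs <;> simp_all

lemma form_vecE_vecE (i j : ℕ) : form _ (vecE m n i) (vecE m n j) = 0 := by
  rw [form_eq_dotProduct]
  simp [dotProduct, vecE, LieAlgebra.Orthogonal.JD, Matrix.mulVec, Fintype.sum_sum_type]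

lemma form_vecE_vecB_last (hp : m - n = q + 1) (i : ℕ) :
    form _ (vecE m n (i + 1)) (vecB m n (n + 1)) = if q = i then -1 else 0 := by
  rw [vecB_last hp, map_sub, map_smul, form_vecE_vecE, form_comm, form_vecU_vecE hp le_rfl]
  split_ifs <;> simp

lemma form_vecB_vecB_last (hp : m - n = q + 1) {i : ℕ} (hi : i ≤ n) :
    form _ (vecB m n (i + 1)) (vecB m n (n + 1)) = if n = i then -2 else 0 := by
  have h : form _ (vecB m n (i + 1)) (vecE m n (q + 1)) =
      -form _ (vecW m n n) (vecB m n (i + 1)) := by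
    rw [vecW_last, map_neg, LinearMap.neg_apply, neg_neg, form_comm, congrArg (vecE m n) hp]
  rw [vecB_last hp, map_sub, map_smul, h, form_vecW_vecB hp le_rfl hi, form_comm,
    form_vecU_vecB hp le_rfl hi]
  split_ifs <;> simp

lemma form_sliceVector (hp : m - n = q + 1) (a y : Fin n → ℂ) (z : Fin (n + 1) → ℂ)
    (d : Fin (m - n - 1) → ℂ) (v v' : Idx m n ⊕ Idx m n → ℂ) :
    form _ v ((sliceVector m n a y z d).mulVec v') =
      ∑ k ∈ Finset.range q, coord d (q - k) *
        (form _ (vecU m n (k + 1)) v' * form _ (vecU m n k) v -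
        form _ (vecU m n k) v' * form _ (vecU m n (k + 1)) v) +
      ∑ k ∈ Finset.range n, coord a (n - k) *
        (form _ (vecW m n (k + 1)) v' * form _ (vecW m n k) v -
        form _ (vecW m n k) v' * form _ (vecW m n (k + 1)) v) +
      ∑ k ∈ Finset.range n, coord y (k + 1) * (form _ (vecW m n k) v' * form _ (vecU m n 0) v -
        form _ (vecU m n 0) v' * form _ (vecW m n k) v) -
      ∑ k ∈ Finset.range (n + 1), coord z (k + 1) *
        (form _ (vecW m n n) v' * form _ (vecU m n k) v -
        form _ (vecU m n k) v' * form _ (vecW m n n) v) := by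
  have h (s : Finset ℕ) (c : ℕ → ℂ) (x y : ℕ → Idx m n ⊕ Idx m n → ℂ) :
      form _ v ((∑ k ∈ s, c k • wedge (x k) (y k)).mulVec v') =
        ∑ k ∈ s, c k * (form _ (y k) v' * form _ (x k) v - form _ (x k) v' * form _ (y k) v) := by
    rw [Matrix.sum_mulVec, map_sum]
    refine Finset.sum_congr rfl fun k _ => ?_
    rw [Matrix.smul_mulVec, map_smul, wedge_mulVec, map_sub, map_smul, map_smul, form_comm v,
      form_comm v]
    simp
  rw [sliceVector_eq hp, Matrix.sub_mulVec, Matrix.add_mulVec, Matrix.add_mulVec, map_sub, map_add,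
    map_add, h, h, h, h]

/-- The vector `∑ t^i e_{i+1}`, an eigenvector of `X_n` for the eigenvalue `t` up to a multiple of
the last vector `e_{m-n}`. -/
def genU (m n : ℕ) (t : ℂ) : Idx m n ⊕ Idx m n → ℂ :=
  ∑ i ∈ Finset.range (m - n), t ^ i • vecE m n (i + 1)

/-- The vector `∑ t^j β_{j+1}`, the analogue of `∑ t^i e_{i+1}` for the vectors `β_j`. -/
def genW (m n : ℕ) (t : ℂ) : Idx m n ⊕ Idx m n → ℂ :=
  ∑ j ∈ Finset.range (n + 1), t ^ j • vecB m n (j + 1)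

lemma smul_genU_sub (hp : m - n = q + 1) (t : ℂ) :
    t • genU m n t - (nilp m n).mulVec (genU m n t) = t ^ (q + 1) • vecE m n (q + 1) := by
  have h := Finset.sum_range_sub (fun i => t ^ i • vecE m n i) (q + 1)
  simp only [vecE_zero, smul_zero, sub_zero] at h
  rw [genU, Finset.smul_sum, Matrix.mulVec_sum, ← Finset.sum_sub_distrib, ← h]
  refine Finset.sum_congr (congrArg Finset.range hp) fun i hi => ?_
  rw [Finset.mem_range] at hi
  rw [Matrix.mulVec_smul, nilp_mulVec_vecE (by omega), Nat.add_sub_cancel, smul_smul, ← pow_succ']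

lemma smul_genW_sub (hp : m - n = q + 1) (t : ℂ) :
    t • genW m n t - (nilp m n).mulVec (genW m n t) = t ^ (n + 1) • vecB m n (n + 1) := by
  have h := Finset.sum_range_sub (fun i => t ^ i • vecB m n i) (n + 1)
  simp only [vecB_zero, smul_zero, sub_zero] at h
  rw [genW, Finset.smul_sum, Matrix.mulVec_sum, ← Finset.sum_sub_distrib, ← h]
  refine Finset.sum_congr rfl fun i hi => ?_
  rw [Finset.mem_range] at hi
  rw [Matrix.mulVec_smul, nilp_mulVec_vecB hp (by omega), Nat.add_sub_cancel, smul_smul,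
    ← pow_succ']

lemma form_genU (hp : m - n = q + 1) {v : Idx m n ⊕ Idx m n → ℂ} {k : ℕ} {c : ℂ} (hk : k ≤ q)
    (h : ∀ i ≤ q, form _ v (vecE m n (i + 1)) = if k = i then c else 0) (t : ℂ) :
    form _ v (genU m n t) = t ^ k * c := by
  rw [genU, map_sum, Finset.sum_eq_single_of_mem k (Finset.mem_range.2 (by omega)), map_smul,
    h k hk, if_pos rfl, smul_eq_mul]
  intro i hi hik
  rw [Finset.mem_range] at hi
  rw [map_smul, h i (by omega), if_neg hik.symm, smul_zero]

lemma form_genW {v : Idx m n ⊕ Idx m n → ℂ} {k : ℕ} {c : ℂ} (hk : k ≤ n)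
    (h : ∀ i ≤ n, form _ v (vecB m n (i + 1)) = if k = i then c else 0) (t : ℂ) :
    form _ v (genW m n t) = t ^ k * c := by
  rw [genW, map_sum, Finset.sum_eq_single_of_mem k (Finset.mem_range.2 (by omega)), map_smul,
    h k hk, if_pos rfl, smul_eq_mul]
  intro i hi hik
  rw [Finset.mem_range] at hi
  rw [map_smul, h i (by omega), if_neg hik.symm, smul_zero]

lemma form_vecU_genU (hp : m - n = q + 1) {k : ℕ} (hk : k ≤ q) (t : ℂ) :
    form _ (vecU m n k) (genU m n t) = t ^ k := by
  rw [form_genU hp hk (fun i _ => form_vecU_vecE hp hk), mul_one]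

lemma form_vecU_genW (hp : m - n = q + 1) {k : ℕ} (hk : k ≤ q) (t : ℂ) :
    form _ (vecU m n k) (genW m n t) = 0 := by
  rw [form_genW (k := 0) (c := 0) (by omega) (fun i hi => by simp [form_vecU_vecB hp hk hi]),
    mul_zero]

lemma form_vecW_genU (hp : m - n = q + 1) {k : ℕ} (hk : k ≤ n) (t : ℂ) :
    form _ (vecW m n k) (genU m n t) = 0 := by
  rw [form_genU hp (k := 0) (c := 0) (by omega) (fun i _ => by simp [form_vecW_vecE hp hk]),
    mul_zero]

lemma form_vecW_genW (hp : m - n = q + 1) {k : ℕ} (hk : k ≤ n) (t : ℂ) :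
    form _ (vecW m n k) (genW m n t) = t ^ k := by
  rw [form_genW hk (fun i hi => form_vecW_vecB hp hk hi), mul_one]

lemma form_vecE_genU (hp : m - n = q + 1) (i : ℕ) (t : ℂ) :
    form _ (vecE m n i) (genU m n t) = 0 := by
  rw [form_genU hp (k := 0) (c := 0) (by omega) (fun j _ => by simp [form_vecE_vecE]), mul_zero]

lemma form_vecB_last_genU (hp : m - n = q + 1) (t : ℂ) :
    form _ (vecB m n (n + 1)) (genU m n t) = -t ^ q := by
  rw [form_genU hp (c := -1) le_rfl
    (fun i _ => by rw [form_comm, form_vecE_vecB_last hp]), mul_neg_one]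

lemma form_vecB_last_genW (hp : m - n = q + 1) (t : ℂ) :
    form _ (vecB m n (n + 1)) (genW m n t) = -2 * t ^ n := by
  rw [form_genW (c := -2) le_rfl (fun i hi => by rw [form_comm, form_vecB_vecB_last hp hi]),
    mul_comm]

end Gram

/-! ### The frame adapted to the pencil `t - S` -/

section Frame

variable {m n q : ℕ}

/-- The index set of the frame in which the pencil `t - S` is reduced. -/
abbrev FrameIdx (n q : ℕ) : Type := Fin 2 ⊕ ((Fin q ⊕ Fin n) ⊕ (Fin q ⊕ Fin n))

/-- The vectors `e_{i+1}` and `β_{j+1}` with positive `i` and `j`, followed by the `u_k` with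
`k < q` and the `w_k` with `k < n`. -/
def frameTail (m n q : ℕ) : (Fin q ⊕ Fin n) ⊕ (Fin q ⊕ Fin n) → Idx m n ⊕ Idx m n → ℂ :=
  Sum.elim (Sum.elim (fun i => vecE m n (i + 1 + 1)) fun j => vecB m n (j + 1 + 1))
    (Sum.elim (fun i => vecU m n i) fun j => vecW m n j)

/-- The frame for the parameter `t`: the two generating vectors `∑ t^i e_{i+1}` and
`∑ t^j β_{j+1}`, followed by the fixed vectors. -/
def frame (m n q : ℕ) (t : ℂ) : FrameIdx n q → Idx m n ⊕ Idx m n → ℂ :=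
  Sum.elim ![genU m n t, genW m n t] (frameTail m n q)

/-- The constant frame with first vectors `e_1` and `β_1`. -/
def frameConst (m n q : ℕ) : FrameIdx n q → Idx m n ⊕ Idx m n → ℂ :=
  Sum.elim ![vecE m n 1, vecB m n 1] (frameTail m n q)

/-- The coefficients of the generating vectors on the fixed vectors. -/
def frameCoeff (n q : ℕ) (t : ℂ) : Matrix ((Fin q ⊕ Fin n) ⊕ (Fin q ⊕ Fin n)) (Fin 2) ℂ :=
  Matrix.of (Sum.elim
    (Sum.elim (fun i => ![t ^ ((i : ℕ) + 1), 0]) fun j => ![0, t ^ ((j : ℕ) + 1)]) fun _ => 0)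

/-- The matrix whose columns are the vectors of a frame. -/
def colMat (b : FrameIdx n q → Idx m n ⊕ Idx m n → ℂ) :
    Matrix (Idx m n ⊕ Idx m n) (FrameIdx n q) ℂ :=
  Matrix.of fun r c => b c r

lemma colMat_frame (hp : m - n = q + 1) (t : ℂ) :
    colMat (frame m n q t) = colMat (frameConst m n q) *
      (Matrix.fromBlocks 1 0 (frameCoeff n q t) 1 : Matrix (FrameIdx n q) (FrameIdx n q) ℂ) := by
  have hU : genU m n t = vecE m n 1 + ∑ i : Fin q, t ^ ((i : ℕ) + 1) • vecE m n (i + 1 + 1) := by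
    rw [genU, Finset.sum_congr (congrArg Finset.range hp) fun _ _ => rfl,
      Finset.sum_range_succ', Finset.sum_range, pow_zero, one_smul, add_comm]
  have hW : genW m n t = vecB m n 1 + ∑ j : Fin n, t ^ ((j : ℕ) + 1) • vecB m n (j + 1 + 1) := by
    rw [genW, Finset.sum_range_succ', Finset.sum_range, pow_zero, one_smul, add_comm]
  ext r (c | c)
  · fin_cases c
    · simp [colMat, frame, hU, Matrix.mul_apply, Fintype.sum_sum_type, frameConst,
        frameTail, frameCoeff, mul_comm]
    · simp [colMat, frame, hW, Matrix.mul_apply, Fintype.sum_sum_type, frameConst,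
        frameTail, frameCoeff, mul_comm]
  · simp [colMat, frame, frameConst, Matrix.mul_apply, Fintype.sum_sum_type, Matrix.one_apply]

/-- The basis vector which carries each vector of the constant frame; `e*_{m-n}` is the one
carrying `β_{n+1}`. -/
def frameEquivFun (hp : m - n = q + 1) : FrameIdx n q → Idx m n ⊕ Idx m n :=
  let b (j : ℕ) : Idx m n ⊕ Idx m n :=
    if h : j < n then Sum.inl (Sum.inr ⟨j, h⟩) else Sum.inr (Sum.inl ⟨q, by omega⟩)
  Sum.elim ![Sum.inl (Sum.inl ⟨0, by omega⟩), b 0]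
    (Sum.elim (Sum.elim (fun i => Sum.inl (Sum.inl ⟨i + 1, by omega⟩)) fun j => b (j + 1))
      (Sum.elim (fun i => Sum.inr (Sum.inl ⟨i, by omega⟩)) fun j => Sum.inr (Sum.inr j)))

lemma frameEquivFun_bijective (hp : m - n = q + 1) :
    Function.Bijective (frameEquivFun hp) := by
  rw [Fintype.bijective_iff_injective_and_card]
  constructor
  · rintro (i | (i | i) | (i | i)) (j | (j | j) | (j | j)) h <;>
    (try fin_cases i) <;> (try fin_cases j) <;>
    simp [frameEquivFun] at h ⊢ <;> grind
  · simp only [Fintype.card_sum, Fintype.card_fin]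
    omega

/-- The involution fixing all basis vectors but `e*_{m-n}`, which it sends to
`e_{m-n} - e*_{m-n}`. -/
def frameInvolution (hp : m - n = q + 1) : Mat (Idx m n) :=
  1 + Matrix.vecMulVec (vecE m n (q + 1) - (2 : ℂ) • Pi.single (Sum.inr (Sum.inl ⟨q, by omega⟩)) 1)
    (Pi.single (Sum.inr (Sum.inl ⟨q, by omega⟩)) 1)

lemma frameInvolution_mul_self (hp : m - n = q + 1) :
    frameInvolution hp * frameInvolution hp = 1 := by
  have h : (Pi.single (Sum.inr (Sum.inl ⟨q, by omega⟩)) 1 : Idx m n ⊕ Idx m n → ℂ) ⬝ᵥ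
      (vecE m n (q + 1) - (2 : ℂ) • Pi.single (Sum.inr (Sum.inl ⟨q, by omega⟩)) 1) = -2 := by
    simp [vecE]
  rw [frameInvolution, mul_add, add_mul, add_mul, Matrix.vecMulVec_mul_vecMulVec, h]
  simp only [mul_one, one_mul]
  rw [Matrix.vecMulVec_smul]
  module

lemma frameConst_eq_submatrix (hp : m - n = q + 1) :
    colMat (frameConst m n q) =
      (frameInvolution hp).submatrix id (frameEquivFun hp) := by
  have hcol (c : Idx m n ⊕ Idx m n) (hc : c ≠ Sum.inr (Sum.inl ⟨q, by omega⟩))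
      (r : Idx m n ⊕ Idx m n) : frameInvolution hp r c = (Pi.single c 1 : _ → ℂ) r := by
    simp [frameInvolution, Matrix.vecMulVec_apply, Pi.single_apply, hc, Matrix.one_apply]
  have hlast (r : Idx m n ⊕ Idx m n) :
      frameInvolution hp r (Sum.inr (Sum.inl ⟨q, by omega⟩)) = vecB m n (n + 1) r := by
    rw [vecB_last hp, vecU_eq (by omega), if_pos hp.symm, vecE_succ (by omega)]
    simp [frameInvolution, Matrix.vecMulVec_apply, Pi.single_apply, Matrix.one_apply,
      vecE_succ (show q < m - n by omega)]
    split_ifs <;> norm_num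
  have hB (j : ℕ) (hj : j ≤ n) (r : Idx m n ⊕ Idx m n) : vecB m n (j + 1) r =
      frameInvolution hp r (if h : j < n then Sum.inl (Sum.inr ⟨j, h⟩)
        else Sum.inr (Sum.inl ⟨q, by omega⟩)) := by
    split_ifs with h
    · rw [hcol _ (by simp), vecB_of_le h, vecF_succ h]
    · rw [hlast, show j = n by omega]
  ext r (c | (c | c) | (c | c))
  · fin_cases c
    · simp [colMat, frameConst, frameEquivFun, hcol, ← vecE_succ]
    · simpa [colMat, frameConst, frameEquivFun] using hB 0 (by omega) r
  · simp [colMat, frameConst, frameTail, frameEquivFun, hcol, ← vecE_succ]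
  · simpa [colMat, frameConst, frameTail, frameEquivFun] using hB (c + 1) c.2 r
  · have hc : (c : ℕ) ≠ q := c.2.ne
    simp only [Matrix.submatrix_apply, id, frameEquivFun, Sum.elim_inl, Sum.elim_inr]
    rw [hcol _ (by simpa using hc)]
    simp [colMat, frameConst, frameTail]
    rw [vecU_eq (by omega), if_neg (by omega), add_zero]
  · simp only [Matrix.submatrix_apply, id, frameEquivFun, Sum.elim_inr]
    rw [hcol _ (by simp)]
    simp [colMat, frameConst, frameTail]
    rw [vecW_of_lt c.2]

end Frame

/-! ### The Gram matrix of the pencil -/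

section Pencil

variable {m n q : ℕ}

/-- The bilinear form `(x, (t - S) y)`. -/
def pencilForm {l : Type} [Fintype l] [DecidableEq l] (S : Mat l) (t : ℂ) (x y : l ⊕ l → ℂ) : ℂ :=
  form l x ((t • (1 : Mat l) - S).mulVec y)

lemma pencilForm_eq {l : Type} [Fintype l] [DecidableEq l] (S : Mat l) (t : ℂ)
    (x y : l ⊕ l → ℂ) : pencilForm S t x y = form l x (t • y - S.mulVec y) := by
  rw [pencilForm, Matrix.sub_mulVec, Matrix.smul_mulVec, Matrix.one_mulVec]

lemma pencilForm_swap {l : Type} [Fintype l] [DecidableEq l] {S : Mat l} (hS : S ∈ soD l) (t : ℂ)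
    (x y : l ⊕ l → ℂ) : pencilForm S t x y = -pencilForm S (-t) y x := by
  rw [pencilForm_eq, pencilForm_eq, map_sub, map_sub, map_smul, map_smul, form_comm y (S.mulVec x),
    form_mulVec_of_mem_soD hS, form_comm y x]
  simp only [smul_eq_mul]
  ring

/-- The Gram matrix of the form `(x, (t - S) y)`, with respect to the frame for `-t` in the first
variable and the frame for `t` in the second. -/
def gram (m n q : ℕ) (S : Mat (Idx m n)) (t : ℂ) : Matrix (FrameIdx n q) (FrameIdx n q) ℂ :=
  Matrix.of fun r c => pencilForm S t (frame m n q (-t) r) (frame m n q t c)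

lemma gram_swap {S : Mat (Idx m n)} (hS : S ∈ soD _) (t : ℂ) (r c : FrameIdx n q) :
    gram m n q S t r c = -gram m n q S (-t) c r := by
  rw [gram, gram, Matrix.of_apply, Matrix.of_apply, pencilForm_swap hS, neg_neg]

lemma det_fromBlocks_frameCoeff (n q : ℕ) (t : ℂ) :
    (Matrix.fromBlocks 1 0 (frameCoeff n q t) 1 : Matrix (FrameIdx n q) (FrameIdx n q) ℂ).det =
      1 := by
  rw [Matrix.det_fromBlocks_zero₁₂, Matrix.det_one, Matrix.det_one, one_mul]

/-- The frame for `t` is the constant frame times a unitriangular matrix, and the constant frame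
is a permutation of the columns of an involution, so the base change does not affect the
determinant. -/
lemma det_gram (hp : m - n = q + 1) (S : Mat (Idx m n)) (t : ℂ) :
    (gram m n q S t).det =
      (-1) ^ Fintype.card (Idx m n) * (t • (1 : Mat (Idx m n)) - S).det := by
  have h : gram m n q S t = (colMat (frame m n q (-t))).transpose *
      (LieAlgebra.Orthogonal.JD _ ℂ * (t • (1 : Mat (Idx m n)) - S)) * colMat (frame m n q t) := by
    ext r c
    rw [gram, Matrix.of_apply, pencilForm, form_eq_dotProduct, Matrix.mulVec_mulVec,
      Matrix.dotProduct_mulVec]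
    rfl
  set K := LieAlgebra.Orthogonal.JD _ ℂ * (t • (1 : Mat (Idx m n)) - S) with hK
  let e := Equiv.ofBijective _ (frameEquivFun_bijective hp)
  have h' : gram m n q S t =
      (Matrix.fromBlocks 1 0 (frameCoeff n q (-t)) 1 :
        Matrix (FrameIdx n q) (FrameIdx n q) ℂ).transpose *
      ((frameInvolution hp).transpose * K * frameInvolution hp).submatrix e e *
      Matrix.fromBlocks 1 0 (frameCoeff n q t) 1 := by
    have he : ((frameInvolution hp).transpose * K * frameInvolution hp).submatrix e e =
        (colMat (frameConst m n q)).transpose * K * colMat (frameConst m n q) := by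
      rw [frameConst_eq_submatrix hp]
      rfl
    rw [h, he, colMat_frame hp, colMat_frame hp, Matrix.transpose_mul]
    simp only [Matrix.mul_assoc]
  have hF : (frameInvolution hp).det * (frameInvolution hp).det = 1 := by
    rw [← Matrix.det_mul, frameInvolution_mul_self, Matrix.det_one]
  rw [h', Matrix.det_mul, Matrix.det_mul, Matrix.det_transpose, det_fromBlocks_frameCoeff,
    det_fromBlocks_frameCoeff, Matrix.det_submatrix_equiv_self, Matrix.det_mul, Matrix.det_mul,
    Matrix.det_transpose, hK, Matrix.det_mul, det_JD]
  linear_combination ((-1) ^ Fintype.card (Idx m n) * (t • (1 : Mat (Idx m n)) - S).det) * hF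

end Pencil

/-! ### The block structure of the Gram matrix -/

section Blocks

variable {m n q : ℕ}

lemma sliceVector_mulVec_eq_zero (hp : m - n = q + 1) (hn : n ≤ q) (a y : Fin n → ℂ)
    (z : Fin (n + 1) → ℂ) (d : Fin (m - n - 1) → ℂ) {v : Idx m n ⊕ Idx m n → ℂ}
    (hU : ∀ k ≤ q, form _ (vecU m n k) v = 0) (hW : ∀ k ≤ n, form _ (vecW m n k) v = 0) :
    (sliceVector m n a y z d).mulVec v = 0 := by
  refine eq_zero_of_form_eq_zero fun x => ?_
  rw [form_sliceVector hp, Finset.sum_eq_zero, Finset.sum_eq_zero, Finset.sum_eq_zero,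
    Finset.sum_eq_zero]
  · simp
  all_goals
    intro k hk
    rw [Finset.mem_range] at hk
    first
    | rw [hU _ (by omega), hU _ (by omega)]; simp
    | rw [hW _ (by omega), hW _ (by omega)]; simp
    | rw [hU _ (by omega), hW _ (by omega)]; simp

lemma nilp_add_sliceVector_mem_soD (m n : ℕ) (a y : Fin n → ℂ) (z : Fin (n + 1) → ℂ)
    (d : Fin (m - n - 1) → ℂ) : nilp m n + sliceVector m n a y z d ∈ soD _ :=
  add_mem (nilp_mem_soD m n) (sliceDirection_le_soD m n ⟨a, y, z, d, rfl⟩)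

variable (a y : Fin n → ℂ) (z : Fin (n + 1) → ℂ) (d : Fin (m - n - 1) → ℂ)

lemma pencilForm_vecU (hp : m - n = q + 1) (hn : n ≤ q) (t : ℂ) (x : Idx m n ⊕ Idx m n → ℂ)
    {k : ℕ} (hk : k < q) : pencilForm (nilp m n + sliceVector m n a y z d) t x (vecU m n k) =
      t * form _ (vecU m n k) x + form _ (vecU m n (k + 1)) x := by
  rw [pencilForm_eq, Matrix.add_mulVec, sliceVector_mulVec_eq_zero hp hn, add_zero,
    nilp_mulVec_vecU (by omega), sub_neg_eq_add, map_add, map_smul, form_comm x, form_comm x,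
    smul_eq_mul]
  · intro i hi
    rw [form_vecU_vecU hp hi, if_neg (by omega)]
  · intro i hi
    rw [form_comm, form_vecU_vecW hp hk.le, if_neg (by omega)]

lemma pencilForm_vecW (hp : m - n = q + 1) (hn : n ≤ q) (t : ℂ) (x : Idx m n ⊕ Idx m n → ℂ)
    {k : ℕ} (hk : k < n) : pencilForm (nilp m n + sliceVector m n a y z d) t x (vecW m n k) =
      t * form _ (vecW m n k) x + form _ (vecW m n (k + 1)) x := by
  rw [pencilForm_eq, Matrix.add_mulVec, sliceVector_mulVec_eq_zero hp hn, add_zero,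
    nilp_mulVec_vecW hk, sub_neg_eq_add, map_add, map_smul, form_comm x, form_comm x,
    smul_eq_mul]
  · intro i hi
    rw [form_vecU_vecW hp hi, if_neg (by omega)]
  · intro i hi
    rw [form_vecW_vecW hp hi]

/-- The upper triangular matrix with ones on the diagonal and `t` on the superdiagonal. -/
def shiftedIdentity (s : ℕ) (t : ℂ) : Matrix (Fin s) (Fin s) ℂ :=
  Matrix.of fun i k => (if (k : ℕ) = i + 1 then t else 0) + if (k : ℕ) = i then 1 else 0

lemma det_shiftedIdentity (s : ℕ) (t : ℂ) : (shiftedIdentity s t).det = 1 := by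
  rw [shiftedIdentity, Matrix.det_of_isUpperTriangular]
  · simp
  · intro i j hij
    have : (j : ℕ) < i := hij
    simp only [Matrix.of_apply]
    rw [if_neg (by omega), if_neg (by omega), add_zero]

lemma gram_inl_inr_inr (hp : m - n = q + 1) (hn : n ≤ q) (t : ℂ) (i : Fin 2) (c : Fin q ⊕ Fin n) :
    gram m n q (nilp m n + sliceVector m n a y z d) t (Sum.inl i) (Sum.inr (Sum.inr c)) = 0 := by
  rcases c with c | c
  · have hc := c.2
    fin_cases i
    · simp [gram, frame, frameTail, pencilForm_vecU a y z d hp hn t _ c.2,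
        form_vecU_genU hp (show (c : ℕ) ≤ q by omega),
        form_vecU_genU hp (show (c : ℕ) + 1 ≤ q by omega)]
      ring
    · simp [gram, frame, frameTail, pencilForm_vecU a y z d hp hn t _ c.2,
        form_vecU_genW hp (show (c : ℕ) ≤ q by omega),
        form_vecU_genW hp (show (c : ℕ) + 1 ≤ q by omega)]
  · have hc := c.2
    fin_cases i
    · simp [gram, frame, frameTail, pencilForm_vecW a y z d hp hn t _ c.2,
        form_vecW_genU hp (show (c : ℕ) ≤ n by omega),
        form_vecW_genU hp (show (c : ℕ) + 1 ≤ n by omega)]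
    · simp [gram, frame, frameTail, pencilForm_vecW a y z d hp hn t _ c.2,
        form_vecW_genW hp (show (c : ℕ) ≤ n by omega),
        form_vecW_genW hp (show (c : ℕ) + 1 ≤ n by omega)]
      ring

lemma gram_inr_inr_inr_inr (hp : m - n = q + 1) (hn : n ≤ q) (t : ℂ) (r c : Fin q ⊕ Fin n) :
    gram m n q (nilp m n + sliceVector m n a y z d) t (Sum.inr (Sum.inr r)) (Sum.inr (Sum.inr c)) =
      0 := by
  rcases c with c | c
  · rw [gram, Matrix.of_apply]
    simp only [frame, frameTail, Sum.elim_inr, Sum.elim_inl]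
    rw [pencilForm_vecU a y z d hp hn t _ c.2]
    rcases r with r | r <;> simp only [Sum.elim_inl, Sum.elim_inr]
    · rw [form_vecU_vecU hp c.2.le, form_vecU_vecU hp c.2, if_neg (by omega), if_neg (by omega)]
      simp
    · rw [form_vecU_vecW hp c.2.le, form_vecU_vecW hp c.2, if_neg (by omega), if_neg (by omega)]
      simp
  · rw [gram, Matrix.of_apply]
    simp only [frame, frameTail, Sum.elim_inr]
    rw [pencilForm_vecW a y z d hp hn t _ c.2]
    rcases r with r | r <;> simp only [Sum.elim_inl, Sum.elim_inr]
    · rw [form_comm, form_vecU_vecW hp r.2.le, form_comm (vecW m n (c + 1)),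
        form_vecU_vecW hp r.2.le, if_neg (by omega), if_neg (by omega)]
      simp
    · rw [form_vecW_vecW hp c.2.le, form_vecW_vecW hp c.2]
      simp

lemma gram_inr_inl_inr_inr (hp : m - n = q + 1) (hn : n ≤ q) (t : ℂ) (r c : Fin q ⊕ Fin n) :
    gram m n q (nilp m n + sliceVector m n a y z d) t (Sum.inr (Sum.inl r)) (Sum.inr (Sum.inr c)) =
      Matrix.fromBlocks (shiftedIdentity q t) 0 0 (shiftedIdentity n t) r c := by
  rcases c with c | c
  · rw [gram, Matrix.of_apply]
    simp only [frame, frameTail, Sum.elim_inr, Sum.elim_inl]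
    rw [pencilForm_vecU a y z d hp hn t _ c.2]
    rcases r with r | r <;> simp only [Sum.elim_inl, Sum.elim_inr]
    · rw [form_vecU_vecE hp c.2.le, form_vecU_vecE hp c.2]
      simp [shiftedIdentity]
    · rw [form_vecU_vecB hp c.2.le r.2, form_vecU_vecB hp c.2 r.2]
      simp
  · rw [gram, Matrix.of_apply]
    simp only [frame, frameTail, Sum.elim_inr]
    rw [pencilForm_vecW a y z d hp hn t _ c.2]
    rcases r with r | r <;> simp only [Sum.elim_inl, Sum.elim_inr]
    · rw [form_vecW_vecE hp c.2.le, form_vecW_vecE hp c.2]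
      simp
    · rw [form_vecW_vecB hp c.2.le r.2, form_vecW_vecB hp c.2 r.2]
      simp [shiftedIdentity]

/-- The Gram matrix is block triangular up to a permutation of the blocks: the vectors `u_k`,
`k < q`, and `w_k`, `k < n`, are isotropic for the form `(x, (t - S) y)`, and the generating
vectors of the frame are orthogonal to them. Only the block of the generating vectors matters, as
the pairings of the other fixed vectors are unitriangular up to sign. -/
lemma det_gram_eq_det_toBlocks (hp : m - n = q + 1) (hn : n ≤ q) (t : ℂ) :
    (gram m n q (nilp m n + sliceVector m n a y z d) t).det =
      (gram m n q (nilp m n + sliceVector m n a y z d) t).toBlocks₁₁.det := by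
  have hS := nilp_add_sliceVector_mem_soD m n a y z d
  set G := gram m n q (nilp m n + sliceVector m n a y z d) with hG
  let T (t : ℂ) : Matrix (Fin q ⊕ Fin n) (Fin q ⊕ Fin n) ℂ :=
    Matrix.fromBlocks (shiftedIdentity q t) 0 0 (shiftedIdentity n t)
  have hT (t : ℂ) : (T t).det = 1 := by
    rw [Matrix.det_fromBlocks_zero₂₁, det_shiftedIdentity, det_shiftedIdentity, one_mul]
  have hT' : (-(T (-t)).transpose).det = (-1) ^ Fintype.card (Fin q ⊕ Fin n) := by
    rw [Matrix.det_neg, Matrix.det_transpose, hT, mul_one]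
  have h : G t = Matrix.fromBlocks (G t).toBlocks₁₁
      (Matrix.fromCols (Matrix.of fun i c => G t (Sum.inl i) (Sum.inr (Sum.inl c))) 0)
      (Matrix.fromRows (Matrix.of fun r i => G t (Sum.inr (Sum.inl r)) (Sum.inl i)) 0)
      (Matrix.fromBlocks (Matrix.of fun r c => G t (Sum.inr (Sum.inl r)) (Sum.inr (Sum.inl c)))
        (T t) (-(T (-t)).transpose) 0) := by
    ext (i | (r | r)) (j | (c | c))
    · rfl
    · rfl
    · exact gram_inl_inr_inr a y z d hp hn t i c
    · rfl
    · rfl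
    · exact gram_inr_inl_inr_inr a y z d hp hn t r c
    · rw [hG, gram_swap hS, gram_inl_inr_inr a y z d hp hn]
      simp
    · rw [hG, gram_swap hS, gram_inr_inl_inr_inr a y z d hp hn]
      rfl
    · exact gram_inr_inr_inr_inr a y z d hp hn t r c
  rw [h, det_fromBlocks_corner _ _ _ _ _ _ (by rw [hT']; exact (isUnit_one.neg).pow _), hT', hT,
    ← mul_pow]
  simp [Matrix.toBlocks₁₁]

end Blocks

/-! ### The characteristic polynomial -/

section Charpoly

variable {m n q : ℕ} (a y : Fin n → ℂ) (z : Fin (n + 1) → ℂ) (d : Fin (m - n - 1) → ℂ)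

lemma sum_Icc_one_eq_sum_range (s : ℕ) (f : ℕ → ℂ) :
    ∑ k ∈ Finset.Icc 1 s, f k = ∑ k ∈ Finset.range s, f (k + 1) := by
  rw [Finset.range_eq_Ico, Finset.sum_Ico_add' f 0 s 1]
  rfl

lemma sum_Icc_one_eq_sum_range_sub (s : ℕ) (f : ℕ → ℂ) :
    ∑ k ∈ Finset.Icc 1 s, f k = ∑ k ∈ Finset.range s, f (s - k) := by
  rw [sum_Icc_one_eq_sum_range, ← Finset.sum_range_reflect]
  refine Finset.sum_congr rfl fun k hk => congrArg f ?_
  rw [Finset.mem_range] at hk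
  omega

lemma eval_polyA (t : ℂ) : (polyA n a).eval t = t ^ (2 * n) +
    ∑ k ∈ Finset.range n, (-1) ^ (n - k) * coord a (n - k) * t ^ (2 * k) := by
  rw [polyA, eval_add, eval_finsetSum, sum_Icc_one_eq_sum_range_sub]
  simp only [eval_mul, eval_pow, eval_C, eval_X]
  congr 1
  refine Finset.sum_congr rfl fun k hk => ?_
  rw [Finset.mem_range] at hk
  rw [Nat.sub_sub_self hk.le]

lemma eval_polyD (hp : m - n = q + 1) (t : ℂ) : (polyD m n d).eval t =
    ∑ k ∈ Finset.range q, (-1) ^ (q - k + 1) * 4 * coord d (q - k) * t ^ (2 * k) := by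
  rw [polyD, eval_finsetSum, sum_Icc_one_eq_sum_range_sub]
  have hq : m - n - 1 = q := by omega
  refine Finset.sum_congr (congrArg _ hq) fun k hk => ?_
  rw [Finset.mem_range] at hk
  simp only [eval_mul, eval_pow, eval_C, eval_X]
  rw [congrArg (coord d) (show m - n - 1 - k = q - k by omega),
    Nat.sub_sub_self (by omega), show m - n - 1 - k + 1 = q - k + 1 by omega]

lemma eval_polyB (hp : m - n = q + 1) (t : ℂ) : (polyB m n y z).eval t =
    ∑ k ∈ Finset.range n, coord y (k + 1) * t ^ k -
      t ^ n * (∑ k ∈ Finset.range (n + 1), coord z (k + 1) * (-t) ^ k + (-t) ^ (q + 1)) := by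
  rw [polyB, hp, eval_sub, eval_mul, eval_add, eval_finsetSum, eval_finsetSum,
    sum_Icc_one_eq_sum_range, sum_Icc_one_eq_sum_range]
  simp only [eval_mul, eval_pow, eval_C, eval_X, Nat.add_sub_cancel]
  congr 3
  · refine Finset.sum_congr rfl fun k _ => ?_
    rw [neg_pow t]
    ring
  · rw [neg_pow t]

/-- The pairing `(v, s v')` for `s` in the direction of the slice depends only on the pairings of
`v` and `v'` with the `u_k` and `w_k`. -/
lemma form_sliceVector_of_moments (hp : m - n = q + 1) (hn : n ≤ q)
    {v v' : Idx m n ⊕ Idx m n → ℂ} {f g f' g' : ℕ → ℂ}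
    (hf : ∀ k ≤ q, form _ (vecU m n k) v = f k) (hg : ∀ k ≤ n, form _ (vecW m n k) v = g k)
    (hf' : ∀ k ≤ q, form _ (vecU m n k) v' = f' k) (hg' : ∀ k ≤ n, form _ (vecW m n k) v' = g' k) :
    form _ v ((sliceVector m n a y z d).mulVec v') =
      ∑ k ∈ Finset.range q, coord d (q - k) * (f' (k + 1) * f k - f' k * f (k + 1)) +
      ∑ k ∈ Finset.range n, coord a (n - k) * (g' (k + 1) * g k - g' k * g (k + 1)) +
      ∑ k ∈ Finset.range n, coord y (k + 1) * (g' k * f 0 - f' 0 * g k) -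
      ∑ k ∈ Finset.range (n + 1), coord z (k + 1) * (g' n * f k - f' k * g n) := by
  rw [form_sliceVector hp]
  congr 1
  · congr 1
    · congr 1
      · refine Finset.sum_congr rfl fun k hk => ?_
        rw [Finset.mem_range] at hk
        rw [hf' (k + 1) hk, hf' k hk.le, hf k hk.le, hf (k + 1) hk]
      · refine Finset.sum_congr rfl fun k hk => ?_
        rw [Finset.mem_range] at hk
        rw [hg' (k + 1) hk, hg' k hk.le, hg k hk.le, hg (k + 1) hk]
    · refine Finset.sum_congr rfl fun k hk => ?_
      rw [Finset.mem_range] at hk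
      rw [hg' k hk.le, hf' 0 (Nat.zero_le q), hg k hk.le, hf 0 (Nat.zero_le q)]
  · refine Finset.sum_congr rfl fun k hk => ?_
    rw [Finset.mem_range] at hk
    rw [hg' n le_rfl, hf' k (by omega), hg n le_rfl, hf k (by omega)]

lemma neg_one_pow_mul_neg_one_pow_sub {k s : ℕ} (h : k ≤ s) :
    (-1 : ℂ) ^ s * (-1) ^ (s - k) = (-1) ^ k := by
  obtain ⟨j, rfl⟩ := Nat.exists_eq_add_of_le h
  rw [Nat.add_sub_cancel_left, pow_add, mul_assoc, ← mul_pow]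
  simp

lemma pencilForm_genU_genU (hp : m - n = q + 1) (hn : n ≤ q) (t : ℂ) :
    2 * pencilForm (nilp m n + sliceVector m n a y z d) t (genU m n (-t)) (genU m n t) =
      (-1) ^ q * t * (polyD m n d).eval t := by
  rw [pencilForm_eq, Matrix.add_mulVec, ← sub_sub, smul_genU_sub hp, map_sub, map_smul, form_comm,
    form_vecE_genU hp, eval_polyD d hp,
    form_sliceVector_of_moments a y z d hp hn (fun k hk => form_vecU_genU hp hk (-t))
      (fun k hk => form_vecW_genU hp hk (-t)) (fun k hk => form_vecU_genU hp hk t)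
      (fun k hk => form_vecW_genU hp hk t)]
  simp only [smul_zero, zero_sub, add_zero, sub_zero, mul_neg, mul_zero, zero_mul, sub_self,
    Finset.sum_const_zero]
  rw [Finset.mul_sum, Finset.mul_sum, ← Finset.sum_neg_distrib]
  refine Finset.sum_congr rfl fun k hk => ?_
  rw [Finset.mem_range] at hk
  rw [neg_pow t, neg_pow t, pow_succ (-1 : ℂ) k, ← neg_one_pow_mul_neg_one_pow_sub hk.le]
  ring

lemma pencilForm_genW_genW (hp : m - n = q + 1) (hn : n ≤ q) (t : ℂ) :
    pencilForm (nilp m n + sliceVector m n a y z d) t (genW m n (-t)) (genW m n t) =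
      -2 * (-1) ^ n * t * (polyA n a).eval t := by
  rw [pencilForm_eq, Matrix.add_mulVec, ← sub_sub, smul_genW_sub hp, map_sub, map_smul, form_comm,
    form_vecB_last_genW hp, eval_polyA,
    form_sliceVector_of_moments a y z d hp hn (fun k hk => form_vecU_genW hp hk (-t))
      (fun k hk => form_vecW_genW hp hk (-t)) (fun k hk => form_vecU_genW hp hk t)
      (fun k hk => form_vecW_genW hp hk t)]
  simp only [add_zero, zero_add, sub_zero, mul_zero, zero_mul, Finset.sum_const_zero, smul_eq_mul]
  rw [mul_add, Finset.mul_sum, sub_eq_add_neg, ← Finset.sum_neg_distrib]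
  congr 1
  · rw [neg_pow t]
    ring
  refine Finset.sum_congr rfl fun k hk => ?_
  rw [Finset.mem_range] at hk
  rw [neg_pow t, neg_pow t, pow_succ (-1 : ℂ) k, ← neg_one_pow_mul_neg_one_pow_sub hk.le]
  ring

lemma pencilForm_genU_genW (hp : m - n = q + 1) (hn : n ≤ q) (t : ℂ) :
    pencilForm (nilp m n + sliceVector m n a y z d) t (genU m n (-t)) (genW m n t) =
      -(polyB m n y z).eval t := by
  rw [pencilForm_eq, Matrix.add_mulVec, ← sub_sub, smul_genW_sub hp, map_sub, map_smul, form_comm,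
    form_vecB_last_genU hp, eval_polyB y z hp,
    form_sliceVector_of_moments a y z d hp hn (fun k hk => form_vecU_genU hp hk (-t))
      (fun k hk => form_vecW_genU hp hk (-t)) (fun k hk => form_vecU_genW hp hk t)
      (fun k hk => form_vecW_genW hp hk t)]
  simp only [zero_add, sub_zero, mul_zero, zero_mul, pow_zero, mul_one, Finset.sum_const_zero,
    smul_eq_mul, mul_left_comm _ (t ^ n), ← Finset.mul_sum]
  ring

/-- Evaluated at `t`, both sides are `(-1)^m` times the determinant of the `2 × 2` Gram matrix of
the two generating vectors, whose entries are `D`, `A` and `±B` up to elementary factors. -/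
lemma charpoly_nilp_add_sliceVector (hp : m - n = q + 1) (hn : n ≤ q) :
    (nilp m n + sliceVector m n a y z d).charpoly =
      X ^ 2 * polyA n a * polyD m n d + (-1) ^ m * polyB m n y z * (polyB m n y z).comp (-X) := by
  refine Polynomial.funext fun t => ?_
  have hS := nilp_add_sliceVector_mem_soD m n a y z d
  have hdet := det_gram hp (nilp m n + sliceVector m n a y z d) t
  have hm : Fintype.card (Idx m n) = m := by
    simp only [Fintype.card_sum, Fintype.card_fin]
    omega
  have h10 : pencilForm (nilp m n + sliceVector m n a y z d) t (genW m n (-t)) (genU m n t) =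
      (polyB m n y z).eval (-t) := by
    have h := pencilForm_genU_genW a y z d hp hn (-t)
    rw [neg_neg] at h
    rw [pencilForm_swap hS, h, neg_neg]
  have h00 := pencilForm_genU_genU a y z d hp hn t
  have h11 := pencilForm_genW_genW a y z d hp hn t
  have h01 := pencilForm_genU_genW a y z d hp hn t
  rw [det_gram_eq_det_toBlocks a y z d hp hn, Matrix.det_fin_two, hm] at hdet
  simp only [Matrix.toBlocks₁₁, gram, frame, Matrix.of_apply, Sum.elim_inl, Matrix.cons_val_zero,
    Matrix.cons_val_one] at hdet
  rw [h01, h10, h11] at hdet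
  have hsq (k : ℕ) : ((-1 : ℂ) ^ k) * (-1) ^ k = 1 := by rw [← mul_pow]; simp
  have hmqn : (-1 : ℂ) ^ m * ((-1) ^ q * (-1) ^ n) = -1 := by
    rw [show m = q + n + 1 by omega, pow_succ, pow_add]
    linear_combination -((-1) ^ n * (-1) ^ n) * hsq q - hsq n
  rw [Matrix.eval_charpoly, Matrix.scalar_apply, ← Matrix.smul_one_eq_diagonal]
  simp only [eval_add, eval_mul, eval_pow, eval_X, eval_neg, eval_one, eval_comp]
  linear_combination (-(-1) ^ m) * hdet - (t • (1 : Mat (Idx m n)) - _).det * hsq m -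
    t * eval t (polyA n a) * (-1) ^ m * (-1) ^ n * h00 -
    t ^ 2 * eval t (polyA n a) * eval t (polyD m n d) * hmqn

end Charpoly

end TypeDSlice

end

theorem mainTheorem5 (m n : ℕ) (hmn : 2 * n + 1 ≤ m) :
    TypeDSlice.HasNilpotentJordanType (TypeDSlice.nilp m n) (2 * (m - n) - 1) (2 * n + 1) ∧
    (∃ S : AffineSubspace ℂ (TypeDSlice.Mat (TypeDSlice.Idx m n)),
      (S : Set (TypeDSlice.Mat (TypeDSlice.Idx m n))) = TypeDSlice.slice m n ∧
      TypeDSlice.IsTransverseSlice (TypeDSlice.nilp m n) S ∧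
      TypeDSlice.IsLambdaInvariant (TypeDSlice.nilp m n)
        (S : Set (TypeDSlice.Mat (TypeDSlice.Idx m n)))) ∧
    ∀ (a y : Fin n → ℂ) (z : Fin (n + 1) → ℂ) (d : Fin (m - n - 1) → ℂ),
      (TypeDSlice.slicePoint m n a y z d).charpoly =
        X ^ 2 * TypeDSlice.polyA n a * TypeDSlice.polyD m n d +
          (-1) ^ m * TypeDSlice.polyB m n y z * (TypeDSlice.polyB m n y z).comp (-X) := by
  obtain ⟨q, hp⟩ : ∃ q, m - n = q + 1 := ⟨m - n - 1, by omega⟩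
  have hn : n ≤ q := by omega
  refine ⟨?_, ⟨AffineSubspace.mk' (TypeDSlice.nilp m n) (TypeDSlice.sliceDirection m n),
    ?_, ?_, ?_⟩, fun a y z d => ?_⟩
  · rw [show 2 * (m - n) - 1 = 2 * q + 1 by omega]
    exact TypeDSlice.nilp_hasNilpotentJordanType hp hn
  · exact TypeDSlice.coe_mk'_sliceDirection hp hn
  · exact TypeDSlice.isTransverseSlice_mk'_sliceDirection hp hn
  · rw [TypeDSlice.coe_mk'_sliceDirection hp hn]
    exact TypeDSlice.slice_isLambdaInvariant hp hn
  · rw [TypeDSlice.slicePoint_eq_add_sliceVector (by omega)]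
    exact TypeDSlice.charpoly_nilp_add_sliceVector a y z d hp hn
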